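/- **Setting.** All algebras are unital algebras over $\mathbb C$; repeated indices in a finite set $\mathcal I$ are summed. A representation of a bialgebra $\mathcal A$ is a square matrix $v$ over $\mathcal A$ with $\Delta v_{ij}=v_{ik}\otimes v_{kj}$ and $\epsilon(v_{ij})=\delta_{ij}$; $(v\otimes w)_{ij,kl}=v_{ik}w_{jl}$; $I$ denotes the unit and also the trivial one-dimensional representation; $\mathrm{Mor}(v,w)$ is the space of complex matrices $M$ with $Mv=wM$. For $a\in\mathcal A$ and a linear functional $\rho$ on $\mathcal A$ put $a*\rho=(\rho\otimes\mathrm{id})\Delta a$ and $\rho*a=(\mathrm{id}\otimes\rho)\Delta a$. Let $\mathcal A=\mathrm{Poly}(H)$ be a Hopf $*$-algebra all of whose representations are completely reducible, and let $\Lambda=(\Lambda_{ij})_{i,j\in\mathcal I}$ be an irreducible representation of $\mathcal A$ with $\Lambda_{ij}^*=\Lambda_{ij}$, such that $\mathrm{Mor}(v\otimes w,\Lambda\otimes v\otimes w)=\{0\}$ for all irreducible representations $v,w$ of $\mathcal A$. Let $\mathcal B=\mathrm{Poly}(G)$ be a $*$-bialgebra which contains $\mathcal A$ as a sub-$*$-bialgebra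 and is generated as an algebra by $\mathcal A$ and elements $p_i=p_i^*$ $(i\in\mathcal I)$, not all in $\mathcal A$, such that $\begin{pmatrix}\Lambda&p\\0&I\end{pmatrix}$ is a representation of $\mathcal B$ and $\Gamma\mathcal A\subset\Gamma$ for $\Gamma=\mathcal A\cdot\mathrm{span}\{p_i\}+\mathcal A$. Let $G$ be described by linear functionals $f_{st},\eta_s$ on $\mathcal A$ and numbers $T_{ij}\in\mathbb C$ $(s,t,i,j\in\mathcal I)$, that is, with $R_{ij,sm}=f_{im}(\Lambda_{js})$ and $Z_{ij,s}=\eta_i(\Lambda_{js})$, assume that $R^2=\mathbf 1$ and that in $\mathcal B$ $$p_sa=(a*f_{st})p_t+a*\eta_s-\Lambda_{st}(\eta_t*a)\qquad(a\in\mathcal A),$$ $$(R-\mathbf 1)_{kl,ij}\bigl(p_ip_j-Z_{ij,s}p_s+T_{ij}-\Lambda_{im}\Lambda_{jn}T_{mn}\bigr)=0 .$$ A pair $(\mathcal C,\Psi)$ is an *analogue of Minkowski space associated with $G$* if there are $x_i\in\mathcal C$ $(i\in\mathcal I)$ such that 1. $\mathcal C$ is a unital $*$-algebra generated by the $x_i$,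 and $\Psi:\mathcal C\to\mathcal B\otimes\mathcal C$ is a unital $*$-homomorphism with $(\epsilon\otimes\mathrm{id})\Psi=\mathrm{id}$, $(\mathrm{id}\otimes\Psi)\Psi=(\Delta\otimes\mathrm{id})\Psi$, $x_i^*=x_i$ and $\Psi x_i=\Lambda_{ij}\otimes x_j+p_i\otimes I$; 2. if $\Psi W\subset\mathcal A\otimes W$ for a linear subspace $W\subset\mathcal C$, then $W\subset\mathbb C I$; 3. if $(\mathcal C',\Psi')$ also satisfies 1 and 2 for some $x_i'\in\mathcal C'$, then there is a unital $*$-homomorphism $\rho:\mathcal C\to\mathcal C'$ with $\rho(x_i)=x_i'$ and $(\mathrm{id}\otimes\rho)\Psi=\Psi'\rho$. **Theorem.** Assume that $$\mathrm{Mor}(I,\Lambda\otimes\Lambda)\cap\ker(R+\mathbf 1)=\{0\}\quad\text{and}\quad \mathrm{Mor}(I,\Lambda\otimes\Lambda\otimes\Lambda)=\{0\}.$$ Let $\mathcal C_0$ be the universal unital algebra generated by $x_i$ $(i\in\mathcal I)$ with the relations $$(R-\mathbf 1)_{kl,ij}\bigl(x_ix_j-Z_{ij,m}x_m+T_{ij}\bigr)=0\qquad(k,l\in\mathcal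 I).$$ Then $\mathcal C_0$ has a $*$-algebra structure with $x_i^*=x_i$ and a unital $*$-homomorphism $\Psi_0:\mathcal C_0\to\mathcal B\otimes\mathcal C_0$ with $\Psi_0x_i=\Lambda_{ij}\otimes x_j+p_i\otimes I$. The pair $(\mathcal C_0,\Psi_0)$ is an analogue of Minkowski space associated with $G$, and a pair $(\mathcal C,\Psi)$, where $\mathcal C$ is a unital $*$-algebra and $\Psi:\mathcal C\to\mathcal B\otimes\mathcal C$ a unital $*$-homomorphism, is an analogue of Minkowski space associated with $G$ if and only if there is a $*$-isomorphism $e:\mathcal C\to\mathcal C_0$ with $(\mathrm{id}\otimes e)\Psi=\Psi_0e$. So $G$ has exactly one analogue of Minkowski space up to $*$-isomorphism. -/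

import Mathlib

open scoped TensorProduct Kronecker

universe u w

namespace InhomQG

/-! ## Representations (matrix corepresentations) and intertwiners -/

section Representations

variable {A : Type*} [Ring A] [Bialgebra ℂ A]

/-- `v` is a representation of the quantum group described by `A`:
`Δ v_ij = ∑ k, v_ik ⊗ v_kj` and `ε (v_ij) = δ_ij`. -/
structure IsRep {n : Type*} [Fintype n] [DecidableEq n] (v : Matrix n n A) : Prop where
  comul : ∀ i j, Coalgebra.comul (R := ℂ) (v i j) = ∑ k, v i k ⊗ₜ[ℂ] v k j
  counit : ∀ i j, Coalgebra.counit (R := ℂ) (v i j) = if i = j then 1 else 0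

/-- `M ∈ Mor(v, w)`, that is `M v = w M`, for a complex matrix `M`. -/
def IsMor {n m : Type*} [Fintype n] [Fintype m]
    (v : Matrix n n A) (w : Matrix m m A) (M : Matrix m n ℂ) : Prop :=
  M.map (algebraMap ℂ A) * v = w * M.map (algebraMap ℂ A)

/-- The trivial one-dimensional representation `I`. -/
def trivialRep (A : Type*) [Ring A] : Matrix Unit Unit A := 1

/-- `W` is an invariant subspace of the carrier space of `v`, that is, a subcomodule for the
coaction `e_j ↦ ∑ i, e_i ⊗ v_ij`. -/
def IsInvariant {n : Type*} [Fintype n] (v : Matrix n n A) (W : Submodule ℂ (n → ℂ)) : Prop :=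
  ∀ φ : A →ₗ[ℂ] ℂ, ∀ x ∈ W, (v.map φ).mulVec x ∈ W

/-- An irreducible representation. -/
structure IsIrrep {n : Type*} [Fintype n] [DecidableEq n] (v : Matrix n n A) : Prop where
  isRep : IsRep v
  nonempty : Nonempty n
  eq_bot_or_eq_top : ∀ W : Submodule ℂ (n → ℂ), IsInvariant v W → W = ⊥ ∨ W = ⊤

/-- Complete reducibility: each invariant subspace has an invariant complement. -/
def IsCompletelyReducible {n : Type*} [Fintype n] (v : Matrix n n A) : Prop :=
  ∀ W : Submodule ℂ (n → ℂ), IsInvariant v W →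
    ∃ W' : Submodule ℂ (n → ℂ), IsInvariant v W' ∧ IsCompl W W'

/-- `a * ρ = (ρ ⊗ id) Δ a`. -/
noncomputable def convLeft (a : A) (ρ : A →ₗ[ℂ] ℂ) : A :=
  TensorProduct.lid ℂ A (ρ.rTensor A (Coalgebra.comul (R := ℂ) a))

/-- `ρ * a = (id ⊗ ρ) Δ a`. -/
noncomputable def convRight (ρ : A →ₗ[ℂ] ℂ) (a : A) : A :=
  TensorProduct.rid ℂ A (ρ.lTensor A (Coalgebra.comul (R := ℂ) a))

end Representations

/-! ## The homogeneous part `H` and the inhomogeneous quantum group `G` -/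

/-- The comultiplication is a `*`-homomorphism. For a bialgebra (Hopf algebra) over `ℂ` with
a conjugate linear, antimultiplicative involution, this is what makes it a `*`-bialgebra
(Hopf `*`-algebra). -/
def IsStarBialgebra (A : Type*) [Ring A] [Bialgebra ℂ A] [StarRing A] [StarModule ℂ A] : Prop :=
  ∀ a : A, Coalgebra.comul (R := ℂ) (star a) = star (Coalgebra.comul (R := ℂ) a)

/-- The standing assumptions on the Hopf `*`-algebra `A = Poly(H)` and on the distinguished
representation `Λ` of `H`. -/
structure IsHomogeneousPart {I A : Type*} [Fintype I] [DecidableEq I] [Ring A] [HopfAlgebra ℂ A]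
    [StarRing A] [StarModule ℂ A] (Λ : Matrix I I A) : Prop where
  star_bialgebra : IsStarBialgebra A
  /-- each representation of `H` is completely reducible -/
  completely_reducible : ∀ (n : ℕ) (v : Matrix (Fin n) (Fin n) A),
    IsRep v → IsCompletelyReducible v
  /-- `Λ` is an irreducible representation of `H` -/
  irreducible : IsIrrep Λ
  /-- `Mor(v ⊗ w, Λ ⊗ v ⊗ w) = 0` for irreducible `v`, `w` -/
  mor_eq_zero : ∀ (n m : ℕ) (v : Matrix (Fin n) (Fin n) A) (w : Matrix (Fin m) (Fin m) A),
    IsIrrep v → IsIrrep w → ∀ M : Matrix (I × Fin n × Fin m) (Fin n × Fin m) ℂ,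
      IsMor (v ⊗ₖ w) (Λ ⊗ₖ (v ⊗ₖ w)) M → M = 0
  /-- `Λ` coincides with its conjugate -/
  star_Λ : ∀ i j, star (Λ i j) = Λ i j

/-- The matrix `R_{ij,sm} = f_im (Λ_js)`. -/
def matR {I A : Type*} [Ring A] [Bialgebra ℂ A] (Λ : Matrix I I A) (f : I → I → A →ₗ[ℂ] ℂ) :
    Matrix (I × I) (I × I) ℂ :=
  fun ij sm => f ij.1 sm.2 (Λ ij.2 sm.1)

/-- The matrix `Z_{ij,s} = η_i (Λ_js)`. -/
def matZ {I A : Type*} [Ring A] [Bialgebra ℂ A] (Λ : Matrix I I A) (η : I → A →ₗ[ℂ] ℂ) :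
    Matrix (I × I) I ℂ :=
  fun ij s => η ij.1 (Λ ij.2 s)

/-- The defining conditions of a bialgebra `B = Poly(G)` built from `A = Poly(H)` (embedded in `B`
by `inc`) and from the translations `p`. -/
structure IsInhomogeneous {I A B : Type*} [Fintype I] [DecidableEq I] [Ring A] [HopfAlgebra ℂ A]
    [Ring B] [Bialgebra ℂ B] (Λ : Matrix I I A) (inc : A →ₐc[ℂ] B) (p : I → B) : Prop where
  /-- `B` is generated by `A` and the `p_s` -/
  generated : Algebra.adjoin ℂ (Set.range inc ∪ Set.range p) = ⊤
  /-- `A` is a sub-bialgebra of `B` -/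
  inc_injective : Function.Injective inc
  /-- the block matrix `(Λ, p; 0, I)` is a representation of `G` -/
  isRep : IsRep (Matrix.fromBlocks (Λ.map inc) (Matrix.of fun (i : I) (_ : Unit) => p i) 0 1)
  /-- not all `p_i` lie in `A` -/
  exists_notMem : ∃ i, p i ∉ Set.range inc
  /-- `Γ A ⊆ Γ`, where `Γ = A · span {p_i} + A` -/
  bimodule : ∀ (i : I) (a : A), ∃ (b : I → A) (c : A), p i * inc a = ∑ t, inc (b t) * p t + inc c

/-- `f`, `η`, `T` are the functionals and numbers that describe the commutation relations of `B`,
with `R² = 1` and with as many quadratic relations among the `p_i` as possible (the rows of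
`R - 1` span the space of all `x` with `x (R + 1) = 0`). -/
structure IsDescribedBy {I A B : Type*} [Fintype I] [DecidableEq I] [Ring A] [HopfAlgebra ℂ A]
    [Ring B] [Bialgebra ℂ B] (Λ : Matrix I I A) (inc : A →ₐc[ℂ] B) (p : I → B)
    (f : I → I → A →ₗ[ℂ] ℂ) (η : I → A →ₗ[ℂ] ℂ) (T : I × I → ℂ) : Prop where
  /-- `p_s a = (a * f_st) p_t + a * η_s - Λ_st (η_t * a)` -/
  commutation : ∀ (s : I) (a : A),
    p s * inc a = ∑ t, inc (convLeft a (f s t)) * p t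
      + inc (convLeft a (η s) - ∑ t, Λ s t * convRight (η t) a)
  R_sq : matR Λ f * matR Λ f = 1
  /-- `(R - 1)_{kl,ij} (p_i p_j - η_i(Λ_js) p_s + T_ij - Λ_im Λ_jn T_mn) = 0` -/
  quadratic : ∀ kl : I × I, ∑ ij : I × I, (matR Λ f - 1) kl ij •
    (p ij.1 * p ij.2 - ∑ s, matZ Λ η ij s • p s + algebraMap ℂ B (T ij)
      - inc (∑ mn : I × I, T mn • (Λ ij.1 mn.1 * Λ ij.2 mn.2))) = 0

/-- The `*`-structure of `B`: a `*`-bialgebra, with the given `*` on `A`, and `p_i* = p_i`. -/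
structure IsStarCompatible {I A B : Type*} [Ring A] [HopfAlgebra ℂ A] [StarRing A]
    [StarModule ℂ A] [Ring B] [Bialgebra ℂ B] [StarRing B] [StarModule ℂ B]
    (inc : A →ₐc[ℂ] B) (p : I → B) : Prop where
  star_bialgebra : IsStarBialgebra B
  inc_star : ∀ a, inc (star a) = star (inc a)
  star_p : ∀ i, star (p i) = p i

/-! ## Analogues of Minkowski space -/

/-- Axioms 1 and 2 of an analogue of Minkowski space, for the generators `x`. -/
structure IsMinkowskiPre {I A B : Type*} [Fintype I] [Ring A] [HopfAlgebra ℂ A]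
    [Ring B] [Bialgebra ℂ B] [StarRing B] [StarModule ℂ B]
    (Λ : Matrix I I A) (inc : A →ₐc[ℂ] B) (p : I → B)
    {C : Type*} [Ring C] [Algebra ℂ C] [StarRing C] [StarModule ℂ C]
    (Ψ : C →⋆ₐ[ℂ] B ⊗[ℂ] C) (x : I → C) : Prop where
  generated : Algebra.adjoin ℂ (Set.range x) = ⊤
  /-- `(ε ⊗ id) Ψ = id` -/
  counit : ∀ c, TensorProduct.lid ℂ C ((Coalgebra.counit (R := ℂ) (A := B)).rTensor C (Ψ c)) = c
  /-- `(id ⊗ Ψ) Ψ = (Δ ⊗ id) Ψ` -/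
  coassoc : ∀ c, Ψ.toAlgHom.toLinearMap.lTensor B (Ψ c) =
    TensorProduct.assoc ℂ B B C ((Coalgebra.comul (R := ℂ) (A := B)).rTensor C (Ψ c))
  star_x : ∀ i, star (x i) = x i
  /-- `Ψ x_i = Λ_ij ⊗ x_j + p_i ⊗ I` -/
  coaction : ∀ i, Ψ (x i) = ∑ j, inc (Λ i j) ⊗ₜ[ℂ] x j + p i ⊗ₜ[ℂ] (1 : C)
  /-- if `Ψ W ⊆ A ⊗ W` for a linear subspace `W` of `C`, then `W ⊆ ℂ I` -/
  eq_scalar : ∀ W : Submodule ℂ C,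
    (∀ y ∈ W, Ψ y ∈ LinearMap.range
      (TensorProduct.map (inc : A →ₐ[ℂ] B).toLinearMap W.subtype)) →
    W ≤ Submodule.span ℂ {1}

/-- `(C, Ψ)` is an analogue of Minkowski space associated with `G`: axioms 1, 2 and the
universality axiom 3. -/
def IsMinkowski {I A B : Type*} [Fintype I] [Ring A] [HopfAlgebra ℂ A]
    [Ring B] [Bialgebra ℂ B] [StarRing B] [StarModule ℂ B]
    (Λ : Matrix I I A) (inc : A →ₐc[ℂ] B) (p : I → B)
    {C : Type w} [Ring C] [Algebra ℂ C] [StarRing C] [StarModule ℂ C]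
    (Ψ : C →⋆ₐ[ℂ] B ⊗[ℂ] C) : Prop :=
  ∃ x : I → C, IsMinkowskiPre Λ inc p Ψ x ∧
    ∀ (C' : Type w) [Ring C'] [Algebra ℂ C'] [StarRing C'] [StarModule ℂ C']
      (Ψ' : C' →⋆ₐ[ℂ] B ⊗[ℂ] C') (x' : I → C'), IsMinkowskiPre Λ inc p Ψ' x' →
      ∃ ρ : C →⋆ₐ[ℂ] C', (∀ i, ρ (x i) = x' i) ∧
        ∀ c, ρ.toAlgHom.toLinearMap.lTensor B (Ψ c) = Ψ' (ρ c)

/-- The relators `(R - 1)_{kl,ij} (x_i x_j - Z_{ij,m} x_m + T_ij)` in the free algebra. -/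
noncomputable def minkowskiRelator {I : Type u} [Fintype I] [DecidableEq I]
    (R : Matrix (I × I) (I × I) ℂ) (Z : Matrix (I × I) I ℂ) (T : I × I → ℂ) (kl : I × I) :
    FreeAlgebra ℂ I :=
  ∑ ij : I × I, (R - 1) kl ij •
    (FreeAlgebra.ι ℂ ij.1 * FreeAlgebra.ι ℂ ij.2 - ∑ m, Z ij m • FreeAlgebra.ι ℂ m
      + algebraMap ℂ (FreeAlgebra ℂ I) (T ij))

/-- The universal unital algebra generated by `x_i` (`i ∈ I`) with the relations
`(R - 1)(x ⊗ x - Z x + T) = 0`. -/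
abbrev MinkowskiAlgebra {I : Type u} [Fintype I] [DecidableEq I]
    (R : Matrix (I × I) (I × I) ℂ) (Z : Matrix (I × I) I ℂ) (T : I × I → ℂ) : Type u :=
  RingQuot fun a b : FreeAlgebra ℂ I => (∃ kl, a = minkowskiRelator R Z T kl) ∧ b = 0

/-- The generators `x_i` of the universal algebra. -/
noncomputable def MinkowskiAlgebra.x {I : Type u} [Fintype I] [DecidableEq I]
    (R : Matrix (I × I) (I × I) ℂ) (Z : Matrix (I × I) I ℂ) (T : I × I → ℂ) (i : I) :
    MinkowskiAlgebra R Z T :=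
  RingQuot.mkAlgHom ℂ _ (FreeAlgebra.ι ℂ i)

end InhomQG

open InhomQG

/-!
Applying `Δ` modulo `A` shows that the `p_i` transform there by the irreducible representation `Λ`,
so they are linearly independent modulo `A`; hence `R` intertwines `Λ ⊗ Λ` with itself. Comparing
the relations with their adjoints and using that `Mor(Λ, Λ ⊗ Λ)` and
`Mor(I, Λ ⊗ Λ) ∩ ker (R + 1)` vanish, one finds that the defining relations of the universal algebra
are real, which gives the `*`-structure. Under `x ↦ Λ ⊗ x + p ⊗ 1` the relators transform by
`Λ ⊗ Λ`. On the universal algebra this makes the coaction well defined. In an arbitrary algebra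
satisfying axioms 1 and 2 it shows that the relators span a subspace `W` with `Ψ W ⊆ A ⊗ W`, so they
are scalars; these scalars form an invariant vector killed by `R + 1` and therefore vanish.

Axiom 2 for the universal algebra rests on a differential calculus twisted by `R`: every `c` of
degree at most `n` has derivatives `∂_s c` of degree less than `n` such that `Ψ c` agrees with
`∑ s, p_s Ψ (∂_s c)` modulo `A ⊗ C` and terms of `B ⊗ C` whose second factor has degree less than
`n - 1`, and such that Euler's formula `∑ s, x_s ∂_s c = n c` holds up to degree less than `n`. If
`Ψ c ∈ A ⊗ C`, then independence of the `p_s` forces the `∂_s c` to have degree less than `n - 1`,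
so `c` has degree less than `n`, and so on down to a scalar.
-/

namespace InhomQG

section Families

variable {k M N B D J K L : Type*} [CommRing k] [AddCommGroup M] [Module k M] [AddCommGroup N]
  [Module k N] [Ring D]

/-- The family `u_j v_l` of all products of members of two families. -/
def outer (u : J → D) (v : K → D) : J × K → D := fun jl => u jl.1 * v jl.2

theorem outer_apply (u : J → D) (v : K → D) (jl : J × K) : outer u v jl = u jl.1 * v jl.2 := rfl

theorem add_outer (u u' : J → D) (v : K → D) : outer (u + u') v = outer u v + outer u' v :=
  funext fun _ => add_mul _ _ _

theorem outer_add (u : J → D) (v v' : K → D) : outer u (v + v') = outer u v + outer u v' :=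
  funext fun _ => mul_add _ _ _

variable [Fintype K]

/-- The scalar matrix `P` applied to the family `v` of vectors, `(P v)_j = P_jl v_l`. -/
def matSmul (P : Matrix J K k) (v : K → M) : J → M := fun j => ∑ l, P j l • v l

infixr:73 "•ᵥ" => matSmul

theorem matSmul_apply (P : Matrix J K k) (v : K → M) (j : J) : (P •ᵥ v) j = ∑ l, P j l • v l := rfl

theorem one_matSmul [DecidableEq K] (v : K → M) : (1 : Matrix K K k) •ᵥ v = v := by
  ext j
  simp [matSmul_apply, Matrix.one_apply]

theorem zero_matSmul (v : K → M) : (0 : Matrix J K k) •ᵥ v = 0 := by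
  ext j
  simp [matSmul_apply]

theorem mul_matSmul [Fintype L] (P : Matrix J K k) (Q : Matrix K L k) (v : L → M) :
    (P * Q) •ᵥ v = P •ᵥ Q •ᵥ v := by
  ext j
  simp only [matSmul_apply, Matrix.mul_apply, Finset.sum_smul, Finset.smul_sum, mul_smul]
  exact Finset.sum_comm

theorem add_matSmul (P Q : Matrix J K k) (v : K → M) : (P + Q) •ᵥ v = P •ᵥ v + Q •ᵥ v := by
  ext j
  simp [matSmul_apply, add_smul, Finset.sum_add_distrib]

theorem sub_matSmul (P Q : Matrix J K k) (v : K → M) : (P - Q) •ᵥ v = P •ᵥ v - Q •ᵥ v := by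
  ext j
  simp [matSmul_apply, sub_smul]

theorem matSmul_add (P : Matrix J K k) (v w : K → M) : P •ᵥ (v + w) = P •ᵥ v + P •ᵥ w := by
  ext j
  simp [matSmul_apply, Finset.sum_add_distrib]

theorem matSmul_sub (P : Matrix J K k) (v w : K → M) : P •ᵥ (v - w) = P •ᵥ v - P •ᵥ w := by
  ext j
  simp [matSmul_apply, smul_sub]

theorem map_matSmul (g : M →ₗ[k] N) (P : Matrix J K k) (v : K → M) :
    g ∘ (P •ᵥ v) = P •ᵥ (g ∘ v) := by
  ext j
  simp [matSmul_apply]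

theorem matSmul_mem {S : Submodule k M} (P : Matrix J K k) {v : K → M} (hv : ∀ l, v l ∈ S)
    (j : J) : (P •ᵥ v) j ∈ S :=
  S.sum_mem fun l _ => S.smul_mem _ (hv l)

variable [Ring B] [Algebra k B] [Algebra k D]

theorem matSmul_eq_mulVec (P : Matrix J K k) (v : K → D) :
    P •ᵥ v = (P.map (algebraMap k D)).mulVec v := by
  ext j
  simp [matSmul_apply, Matrix.mulVec, dotProduct, Algebra.smul_def]

theorem matSmul_algebraMap_comp (P : Matrix J K k) (T : K → k) :
    P •ᵥ (algebraMap k D ∘ T) = algebraMap k D ∘ P.mulVec T := by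
  ext j
  simp [matSmul_apply, Matrix.mulVec, dotProduct, Algebra.smul_def]

variable (k) in
/-- The matrix `v` over `B` applied to the family `y`, `(v ⊗ y)_j = v_jl ⊗ y_l`. -/
def tensorMulVec (v : Matrix J K B) (y : K → M) : J → B ⊗[k] M := fun j => ∑ l, v j l ⊗ₜ[k] y l

notation:70 v:70 "⊗ᵥ[" k "]" y:71 => tensorMulVec k v y

theorem tensorMulVec_apply (v : Matrix J K B) (y : K → M) (j : J) :
    (v ⊗ᵥ[k] y) j = ∑ l, v j l ⊗ₜ[k] y l := rfl

theorem add_tensorMulVec (v w : Matrix J K B) (y : K → M) :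
    (v + w) ⊗ᵥ[k] y = v ⊗ᵥ[k] y + w ⊗ᵥ[k] y := by
  ext j
  simp [tensorMulVec_apply, TensorProduct.add_tmul, Finset.sum_add_distrib]

theorem sub_tensorMulVec (v w : Matrix J K B) (y : K → M) :
    (v - w) ⊗ᵥ[k] y = v ⊗ᵥ[k] y - w ⊗ᵥ[k] y := by
  ext j
  simp [tensorMulVec_apply, TensorProduct.sub_tmul]

theorem tensorMulVec_add (v : Matrix J K B) (y z : K → M) :
    v ⊗ᵥ[k] (y + z) = v ⊗ᵥ[k] y + v ⊗ᵥ[k] z := by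
  ext j
  simp [tensorMulVec_apply, TensorProduct.tmul_add, Finset.sum_add_distrib]

theorem tensorMulVec_sub (v : Matrix J K B) (y z : K → M) :
    v ⊗ᵥ[k] (y - z) = v ⊗ᵥ[k] y - v ⊗ᵥ[k] z := by
  ext j
  simp [tensorMulVec_apply, TensorProduct.tmul_sub]

theorem tensorMulVec_matSmul [Fintype L] (v : Matrix J K B) (P : Matrix K L k) (y : L → M) :
    v ⊗ᵥ[k] (P •ᵥ y) = (v * P.map (algebraMap k B)) ⊗ᵥ[k] y := by
  ext j
  simp only [tensorMulVec_apply, matSmul_apply, Matrix.mul_apply, Matrix.map_apply,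
    TensorProduct.tmul_sum, TensorProduct.sum_tmul, TensorProduct.tmul_smul,
    TensorProduct.smul_tmul', Algebra.smul_def (A := B), Algebra.commutes]
  exact Finset.sum_comm

theorem map_mul_tensorMulVec [Fintype L] (P : Matrix J L k) (v : Matrix L K B) (y : K → M) :
    (P.map (algebraMap k B) * v) ⊗ᵥ[k] y = P •ᵥ (v ⊗ᵥ[k] y) := by
  ext j
  simp only [tensorMulVec_apply, matSmul_apply, Matrix.mul_apply, Matrix.map_apply,
    TensorProduct.sum_tmul, Finset.smul_sum, TensorProduct.smul_tmul', Algebra.smul_def (A := B)]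
  exact Finset.sum_comm

theorem lTensor_comp_tensorMulVec_add [Fintype L] (g : M →ₗ[k] N) (v : Matrix J K B) (y : K → M)
    (w : Matrix J L B) (z : L → M) : g.lTensor B ∘ (v ⊗ᵥ[k] y + w ⊗ᵥ[k] z) =
      v ⊗ᵥ[k] (g ∘ y) + w ⊗ᵥ[k] (g ∘ z) := by
  ext j
  simp [tensorMulVec_apply]

theorem tensorMulVec_zero (v : Matrix J K B) : v ⊗ᵥ[k] (0 : K → M) = 0 := by
  ext j
  simp [tensorMulVec_apply]

theorem outer_tensorMulVec [Fintype L] {J' : Type*} (v : Matrix J K B) (w : Matrix J' L B)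
    (y : K → D) (z : L → D) :
    outer (v ⊗ᵥ[k] y) (w ⊗ᵥ[k] z) = (v ⊗ₖ w) ⊗ᵥ[k] outer y z := by
  ext j
  simp [outer_apply, tensorMulVec_apply, Finset.sum_mul_sum, Fintype.sum_prod_type]

end Families

section Intertwiners

variable {A : Type*} [Ring A] [Bialgebra ℂ A] {m n : Type*} [Fintype m] [Fintype n]
  {v : Matrix n n A} {w : Matrix m m A}

/-- `M v - w M`, which vanishes if and only if `M ∈ Mor(v, w)`. -/
noncomputable def morDefect (v : Matrix n n A) (w : Matrix m m A) (M : Matrix m n ℂ) :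
    Matrix m n A :=
  M.map (algebraMap ℂ A) * v - w * M.map (algebraMap ℂ A)

theorem isMor_iff_morDefect_eq_zero {M : Matrix m n ℂ} : IsMor v w M ↔ morDefect v w M = 0 :=
  sub_eq_zero.symm

theorem morDefect_add (v : Matrix n n A) (w : Matrix m m A) (M N : Matrix m n ℂ) :
    morDefect v w (M + N) = morDefect v w M + morDefect v w N := by
  simp only [morDefect, Matrix.map_add _ (map_add (algebraMap ℂ A)), Matrix.add_mul, Matrix.mul_add]
  abel

theorem IsMor.map_mul_morDefect {l : Type*} [Fintype l] {u : Matrix l l A} {P : Matrix l m ℂ}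
    (hP : IsMor w u P) (M : Matrix m n ℂ) :
    P.map (algebraMap ℂ A) * morDefect v w M = morDefect v u (P * M) := by
  rw [IsMor] at hP
  rw [morDefect, morDefect, Matrix.mul_sub, Matrix.map_mul, ← Matrix.mul_assoc, ← Matrix.mul_assoc,
    ← Matrix.mul_assoc, hP]

theorem IsMor.sub_one [DecidableEq n] {M : Matrix n n ℂ} (hM : IsMor v v M) :
    IsMor v v (M - 1) := by
  rw [IsMor] at hM ⊢
  simp [Matrix.map_sub, sub_mul, mul_sub, hM]

end Intertwiners

section Representations

variable {A B : Type*} [Ring A] [Ring B] {n : Type*} [Fintype n] [DecidableEq n]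

section Bialgebra

variable [Bialgebra ℂ A] [Bialgebra ℂ B]

theorem IsIrrep.eq_bot_or_eq_top_of_vecMul_mem {v : Matrix n n A} (hv : IsIrrep v)
    (V : Submodule ℂ (n → ℂ))
    (hV : ∀ φ : A →ₗ[ℂ] ℂ, ∀ c ∈ V, Matrix.vecMul c (v.map φ) ∈ V) : V = ⊥ ∨ V = ⊤ := by
  let e := dotProductEquiv ℂ n
  let U := V.map e.toLinearMap
  have hU : IsInvariant v U.dualCoannihilator := by
    intro φ x hx
    simp only [U, Submodule.mem_dualCoannihilator, Submodule.mem_map, forall_exists_index, and_imp,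
      forall_apply_eq_imp_iff₂] at hx ⊢
    intro c hc
    simpa [e, Matrix.dotProduct_mulVec] using hx _ (hV φ c hc)
  have hVU : V = (U.dualCoannihilator.dualAnnihilator).comap e.toLinearMap := by
    rw [Subspace.dualCoannihilator_dualAnnihilator_eq,
      Submodule.comap_map_eq_of_injective e.injective]
  refine (hv.eq_bot_or_eq_top _ hU).symm.imp (fun h => ?_) fun h => ?_
  · rw [hVU, h, Submodule.dualAnnihilator_top, Submodule.comap_bot, e.ker]
  · rw [hVU, h, Submodule.dualAnnihilator_bot, Submodule.comap_top]

theorem comul_inc (inc : A →ₐc[ℂ] B) (a : A) : Coalgebra.comul (R := ℂ) (inc a) =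
    TensorProduct.map (inc : A →ₐ[ℂ] B).toLinearMap (inc : A →ₐ[ℂ] B).toLinearMap
      (Coalgebra.comul (R := ℂ) a) :=
  (CoalgHomClass.map_comp_comul_apply inc a).symm

theorem IsRep.comul_inc {v : Matrix n n A} (hv : IsRep v) (inc : A →ₐc[ℂ] B) (i j : n) :
    Coalgebra.comul (R := ℂ) (inc (v i j)) = ∑ k, inc (v i k) ⊗ₜ[ℂ] inc (v k j) := by
  rw [InhomQG.comul_inc, hv.comul, map_sum]
  rfl

theorem IsRep.convLeft_apply {v : Matrix n n A} (hv : IsRep v) (ρ : A →ₗ[ℂ] ℂ) (i j : n) :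
    convLeft (v i j) ρ = ∑ k, ρ (v i k) • v k j := by
  simp [convLeft, hv.comul]

theorem IsRep.convRight_apply {v : Matrix n n A} (hv : IsRep v) (ρ : A →ₗ[ℂ] ℂ) (i j : n) :
    convRight ρ (v i j) = ∑ k, ρ (v k j) • v i k := by
  simp [convRight, hv.comul]

end Bialgebra

theorem IsRep.mul_map_antipode [HopfAlgebra ℂ A] {v : Matrix n n A} (hv : IsRep v) :
    v * v.map (HopfAlgebra.antipode ℂ) = 1 := by
  ext i j
  have h := HopfAlgebra.mul_antipode_lTensor_comul_apply (R := ℂ) (v i j)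
  rw [hv.comul, hv.counit, map_sum, map_sum] at h
  simpa [Matrix.mul_apply, Matrix.one_apply, apply_ite (algebraMap ℂ A)] using h

end Representations

section Relators

variable {I k D E : Type*} [Fintype I] [DecidableEq I] [CommRing k] [Ring D] [Algebra k D] [Ring E]
  [Algebra k E]

/-- The relators `(R - 1)(y ⊗ y - Z y + T)` evaluated at the family `y`. -/
def relator (R : Matrix (I × I) (I × I) k) (Z : Matrix (I × I) I k) (T : I × I → k) (y : I → D) :
    I × I → D :=
  (R - 1) •ᵥ (outer y y - Z •ᵥ y + algebraMap k D ∘ T)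

theorem map_comp_relator (φ : D →ₐ[k] E) (R : Matrix (I × I) (I × I) k) (Z : Matrix (I × I) I k)
    (T : I × I → k) (y : I → D) : φ ∘ relator R Z T y = relator R Z T (φ ∘ y) := by
  ext kl
  simp [relator, matSmul_apply, outer_apply]

theorem map_relator (φ : D →ₐ[k] E) (R : Matrix (I × I) (I × I) k) (Z : Matrix (I × I) I k)
    (T : I × I → k) (y : I → D) (kl : I × I) :
    φ (relator R Z T y kl) = relator R Z T (φ ∘ y) kl :=
  congrFun (map_comp_relator φ R Z T y) kl

theorem relator_congr {R : Matrix (I × I) (I × I) k} {Z Z' : Matrix (I × I) I k} {T T' : I × I → k}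
    (hZ : (R - 1) * Z = (R - 1) * Z') (hT : (R - 1).mulVec T = (R - 1).mulVec T') (y : I → D) :
    relator R Z T y = relator R Z' T' y := by
  simp only [relator, matSmul_add, matSmul_sub, ← mul_matSmul, matSmul_algebraMap_comp, hZ, hT]

theorem relator_sub_relator (R : Matrix (I × I) (I × I) k) (Z : Matrix (I × I) I k)
    (T T' : I × I → k) (y : I → D) :
    relator R Z T y - relator R Z T' y = algebraMap k D ∘ (R - 1).mulVec (T - T') := by
  rw [relator, relator, ← matSmul_sub, ← matSmul_algebraMap_comp, add_sub_add_left_eq_sub]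
  exact congrArg _ (funext fun _ => (map_sub _ _ _).symm)

theorem matSmul_outer_mem_span {R : Matrix (I × I) (I × I) k} {Z : Matrix (I × I) I k}
    {T : I × I → k} {y : I → D} (h : relator R Z T y = 0) (kl : I × I) :
    ((R - 1) •ᵥ outer y y) kl ∈ Submodule.span k (insert 1 (Set.range y)) := by
  rw [relator, matSmul_add, matSmul_sub, sub_add, sub_eq_zero] at h
  rw [h, ← matSmul_sub]
  refine matSmul_mem _ (fun ij => sub_mem (matSmul_mem _ (fun i => ?_) _) ?_) kl
  · exact Submodule.subset_span (Set.mem_insert_of_mem _ ⟨i, rfl⟩)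
  · rw [Function.comp_apply, Algebra.algebraMap_eq_smul_one]
    exact Submodule.smul_mem _ _ (Submodule.subset_span (Set.mem_insert _ _))

end Relators

section Conjugation

variable {I k D E : Type*} [CommRing k] [StarRing k] [Ring D]

/-- The conjugate `X̄` of a matrix with rows indexed by `I × I`; conjugation reverses products, so
the two row indices trade places. -/
def swapConj {n α : Type*} [Star α] (X : Matrix (I × I) n α) : Matrix (I × I) n α :=
  (X.map star).submatrix Prod.swap id

/-- The conjugate of a square matrix with rows and columns indexed by `I × I`. -/
def swapConjSq {α : Type*} [Star α] (X : Matrix (I × I) (I × I) α) : Matrix (I × I) (I × I) α :=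
  (X.map star).submatrix Prod.swap Prod.swap

theorem swapConjSq_sub_one [DecidableEq I] (P : Matrix (I × I) (I × I) k) :
    swapConjSq (P - 1) = swapConjSq P - 1 := by
  ext ij kl
  simp [swapConjSq, Matrix.one_apply, apply_ite star, Prod.ext_iff, and_comm]

variable [Fintype I] [DecidableEq I]

/-- The conditions on `R`, `Z`, `T` under which the relations `(R - 1)(y ⊗ y - Z y + T) = 0` are
preserved by an involution with `y_i* = y_i`. -/
structure IsReal (R : Matrix (I × I) (I × I) k) (Z : Matrix (I × I) I k) (T : I × I → k) :
    Prop where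
  conj_R : swapConjSq R = R
  conj_Z : (R - 1) * swapConj Z = (R - 1) * Z
  conj_T : (R - 1).mulVec (star T ∘ Prod.swap) = (R - 1).mulVec T

theorem antihom_relator [Algebra k D] [Ring E] [Algebra k E] (σ : D →+* Eᵐᵒᵖ)
    (hσ : ∀ (c : k) d, σ (c • d) = star c • σ d) (R : Matrix (I × I) (I × I) k)
    (Z : Matrix (I × I) I k) (T : I × I → k) (y : I → D) (kl : I × I) :
    (σ (relator R Z T y kl.swap)).unop =
      relator (swapConjSq R) (swapConj Z) (star T ∘ Prod.swap) (fun i => (σ (y i)).unop) kl := by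
  have hσ' : ∀ c, σ (algebraMap k D c) = algebraMap k Eᵐᵒᵖ (star c) := fun c => by
    rw [Algebra.algebraMap_eq_smul_one, hσ, map_one, Algebra.algebraMap_eq_smul_one]
  simp only [relator, matSmul_apply, map_sum, hσ, Finset.unop_sum, MulOpposite.unop_smul]
  refine Fintype.sum_equiv (Equiv.prodComm I I) _ _ fun ij => congrArg₂ (· • ·) ?_ ?_
  · rw [← swapConjSq_sub_one]
    rfl
  · simp [outer_apply, matSmul_apply, swapConj, hσ, hσ']

theorem IsReal.antihom_relator [Algebra k D] [Ring E] [Algebra k E] {R : Matrix (I × I) (I × I) k}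
    {Z : Matrix (I × I) I k} {T : I × I → k} (h : IsReal R Z T) (σ : D →+* Eᵐᵒᵖ)
    (hσ : ∀ (c : k) d, σ (c • d) = star c • σ d) (y : I → D) (kl : I × I) :
    (σ (relator R Z T y kl.swap)).unop = relator R Z T (fun i => (σ (y i)).unop) kl := by
  rw [InhomQG.antihom_relator σ hσ, h.conj_R, relator_congr h.conj_Z h.conj_T]

end Conjugation

section Kronecker

variable {I J n B : Type*} [Ring B]

/-- The product of the column `u` and the matrix `v`, with rows indexed by pairs: `u_i v_jn`. -/
def vecKron (u : I → B) (v : Matrix J n B) : Matrix (I × J) n B :=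
  Matrix.of fun ij l => u ij.1 * v ij.2 l

/-- The product of the matrix `v` and the column `u`, with rows indexed by pairs: `v_jn u_i`. -/
def kronVec (v : Matrix J n B) (u : I → B) : Matrix (J × I) n B :=
  Matrix.of fun ji l => v ji.1 l * u ji.2

theorem vecKron_mul {m : Type*} [Fintype n] (u : I → B) (v : Matrix J n B) (w : Matrix n m B) :
    vecKron u v * w = vecKron u (v * w) := by
  ext
  simp [vecKron, Matrix.mul_apply, Finset.mul_sum, mul_assoc]

theorem swapConj_vecKron [StarRing B] {u : I → B} {v : Matrix I n B} (hu : ∀ i, star (u i) = u i)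
    (hv : ∀ i l, star (v i l) = v i l) : swapConj (vecKron u v) = kronVec v u := by
  ext
  simp [swapConj, vecKron, kronVec, hu, hv]

theorem outer_tensor_one_tensorMulVec {k D : Type*} [CommRing k] [Algebra k B] [Ring D]
    [Algebra k D] [Fintype n] (u : I → B) (v : Matrix J n B) (y : n → D) :
    outer (fun i => u i ⊗ₜ[k] (1 : D)) (v ⊗ᵥ[k] y) = vecKron u v ⊗ᵥ[k] y := by
  ext
  simp [outer_apply, tensorMulVec_apply, vecKron, Finset.mul_sum]

theorem outer_tensorMulVec_tensor_one {k D : Type*} [CommRing k] [Algebra k B] [Ring D]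
    [Algebra k D] [Fintype n] (v : Matrix J n B) (y : n → D) (u : I → B) :
    outer (v ⊗ᵥ[k] y) (fun i => u i ⊗ₜ[k] (1 : D)) = kronVec v u ⊗ᵥ[k] y := by
  ext
  simp [outer_apply, tensorMulVec_apply, kronVec, Finset.sum_mul]

end Kronecker

section Relations

variable {I A B : Type*} [Ring A] [HopfAlgebra ℂ A] [Ring B] [Bialgebra ℂ B] {Λ : Matrix I I A}
  {inc : A →ₐc[ℂ] B}

theorem kroneckerMap_map_inc : (Λ.map inc) ⊗ₖ (Λ.map inc) = (Λ ⊗ₖ Λ).map inc :=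
  Matrix.ext fun _ _ => (map_mul inc _ _).symm

theorem map_algebraMap_map_inc {m n : Type*} (P : Matrix m n ℂ) :
    (P.map (algebraMap ℂ A)).map inc = P.map (algebraMap ℂ B) := by
  ext
  exact AlgHomClass.commutes inc _

theorem IsMor.matSmul_tensorMulVec {m n N : Type*} [Fintype m] [Fintype n] [AddCommGroup N]
    [Module ℂ N] {v : Matrix n n A} {w : Matrix m m A} {M : Matrix m n ℂ} (hM : IsMor v w M)
    (y : n → N) :
    M •ᵥ ((v.map inc) ⊗ᵥ[ℂ] y) = (w.map inc) ⊗ᵥ[ℂ] (M •ᵥ y) := by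
  rw [tensorMulVec_matSmul, ← map_mul_tensorMulVec, ← map_algebraMap_map_inc (inc := inc),
    ← Matrix.map_mul, ← Matrix.map_mul, hM]

theorem map_morDefect_tensorMulVec {m n N : Type*} [Fintype m] [Fintype n] [AddCommGroup N]
    [Module ℂ N] (v : Matrix n n A) (w : Matrix m m A) (M : Matrix m n ℂ) (y : n → N) :
    ((morDefect v w M).map inc) ⊗ᵥ[ℂ] y =
      M •ᵥ ((v.map inc) ⊗ᵥ[ℂ] y) - (w.map inc) ⊗ᵥ[ℂ] (M •ᵥ y) := by
  rw [tensorMulVec_matSmul, ← map_mul_tensorMulVec, ← sub_tensorMulVec,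
    ← map_algebraMap_map_inc (inc := inc), ← Matrix.map_mul, ← Matrix.map_mul,
    ← Matrix.map_sub _ (map_sub inc), morDefect]

variable [Fintype I] [DecidableEq I] {p : I → B} {f : I → I → A →ₗ[ℂ] ℂ} {η : I → A →ₗ[ℂ] ℂ}
  {R : Matrix (I × I) (I × I) ℂ} {Z : Matrix (I × I) I ℂ} {T : I × I → ℂ}

/-- The commutation relations of `p` with `Λ` and the quadratic relations of `p`, in matrix form:
`p ⊗ Λ = R (Λ ⊗ p) + Z Λ - (Λ ⊗ Λ) Z` and `(R - 1)(p ⊗ p - Z p + T - (Λ ⊗ Λ) T) = 0`. -/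
structure SatisfiesRelations (Λ : Matrix I I A) (inc : A →ₐc[ℂ] B) (p : I → B)
    (R : Matrix (I × I) (I × I) ℂ) (Z : Matrix (I × I) I ℂ) (T : I × I → ℂ) : Prop where
  commutation : vecKron p (Λ.map inc) = R.map (algebraMap ℂ B) * kronVec (Λ.map inc) p
    + (morDefect Λ (Λ ⊗ₖ Λ) Z).map inc
  R_sq : R * R = 1
  quadratic : relator R Z T p =
    (R - 1) •ᵥ (inc ∘ (Λ ⊗ₖ Λ).mulVec (algebraMap ℂ A ∘ T))

theorem IsDescribedBy.satisfiesRelations (hd : IsDescribedBy Λ inc p f η T) (hΛ : IsRep Λ) :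
    SatisfiesRelations Λ inc p (matR Λ f) (matZ Λ η) T where
  commutation := by
    ext ⟨i, j⟩ n
    refine (hd.commutation i (Λ j n)).trans (congrArg₂ (· + ·) ?_ (congrArg inc ?_))
    · simp only [hΛ.convLeft_apply, map_sum, map_smul, Finset.sum_mul, Matrix.mul_apply,
        Fintype.sum_prod_type_right, kronVec, Matrix.map_apply, Matrix.of_apply,
        Algebra.smul_def (A := B), mul_assoc]
      rfl
    · simp only [hΛ.convLeft_apply, hΛ.convRight_apply, morDefect, Matrix.sub_apply,
        Matrix.mul_apply, Fintype.sum_prod_type, Finset.mul_sum, Matrix.map_apply,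
        Matrix.kroneckerMap_apply, Algebra.smul_def (A := A), Algebra.commutes, mul_assoc]
      rfl
  R_sq := hd.R_sq
  quadratic := by
    rw [relator, ← sub_eq_zero, ← matSmul_sub]
    ext kl
    rw [Pi.zero_apply, ← hd.quadratic kl]
    simp [matSmul_apply, outer_apply, Matrix.mulVec, dotProduct, Algebra.smul_def, Algebra.commutes]

namespace SatisfiesRelations

variable (h : SatisfiesRelations Λ inc p R Z T)
include h

theorem kronVec_eq : kronVec (Λ.map inc) p = R.map (algebraMap ℂ B) * vecKron p (Λ.map inc)
    - (R.map (algebraMap ℂ A) * morDefect Λ (Λ ⊗ₖ Λ) Z).map inc := by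
  rw [h.commutation, Matrix.map_mul, map_algebraMap_map_inc, Matrix.mul_add, ← Matrix.mul_assoc,
    ← Matrix.map_mul, h.R_sq, Matrix.map_one _ (map_zero _) (map_one _), Matrix.one_mul,
    add_sub_cancel_right]

theorem sub_one_mul_add_one : (R - 1) * (R + 1) = 0 := by
  rw [sub_mul, mul_add, h.R_sq]
  simp [add_comm]

theorem add_one_mul_sub_one : (R + 1) * (R - 1) = 0 := by
  rw [add_mul, mul_sub, h.R_sq]
  simp

theorem quadratic_of_isMor (hR : IsMor (Λ ⊗ₖ Λ) (Λ ⊗ₖ Λ) R) :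
    relator R Z T p = inc ∘ (Λ ⊗ₖ Λ).mulVec (algebraMap ℂ A ∘ (R - 1).mulVec T) := by
  refine h.quadratic.trans ((map_matSmul (inc : A →ₐ[ℂ] B).toLinearMap _ _).symm.trans ?_)
  rw [matSmul_eq_mulVec, Matrix.mulVec_mulVec, hR.sub_one, ← Matrix.mulVec_mulVec,
    ← matSmul_eq_mulVec, matSmul_algebraMap_comp]
  rfl

end SatisfiesRelations

end Relations

section Translations

variable {I A B : Type*} [Ring A] [HopfAlgebra ℂ A] [Ring B] [Bialgebra ℂ B] {Λ : Matrix I I A}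
  {inc : A →ₐc[ℂ] B} {p : I → B}

/-- The image of `A` in `B` as a linear subspace. -/
def incRange (inc : A →ₐc[ℂ] B) : Submodule ℂ B := LinearMap.range (inc : A →ₐ[ℂ] B).toLinearMap

theorem inc_mem_incRange (inc : A →ₐc[ℂ] B) (a : A) : inc a ∈ incRange inc := ⟨a, rfl⟩

theorem one_mem_incRange (inc : A →ₐc[ℂ] B) : 1 ∈ incRange inc :=
  map_one inc ▸ inc_mem_incRange inc 1

theorem mul_inc_mem_incRange {b : B} (hb : b ∈ incRange inc) (a : A) :
    b * inc a ∈ incRange inc := by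
  obtain ⟨c, rfl⟩ := hb
  exact ⟨c * a, map_mul inc c a⟩

theorem incRange_mul_self : incRange inc * incRange inc ≤ incRange inc :=
  Submodule.mul_le.mpr fun _ hb _ ⟨a, ha⟩ => ha ▸ mul_inc_mem_incRange hb a

theorem mkQ_inc (inc : A →ₐc[ℂ] B) (a : A) : (incRange inc).mkQ (inc a) = 0 :=
  (Submodule.Quotient.mk_eq_zero _).mpr (inc_mem_incRange inc a)

theorem mkQ_comp_col_map_inc {m n : Type*} (v : Matrix m n A) (j : n) :
    (incRange inc).mkQ ∘ (v.map inc).col j = 0 :=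
  funext fun i => mkQ_inc inc (v i j)

theorem mkQ_one (inc : A →ₐc[ℂ] B) : (incRange inc).mkQ 1 = 0 := map_one inc ▸ mkQ_inc inc 1

/-- The contraction `x ⊗ y ↦ φ(x) y`. -/
noncomputable def contractLeft {M : Type*} [AddCommGroup M] [Module ℂ M] (φ : B →ₗ[ℂ] ℂ) :
    B ⊗[ℂ] M →ₗ[ℂ] M :=
  (TensorProduct.lid ℂ M).toLinearMap ∘ₗ φ.rTensor M

theorem contractLeft_comp_tensorMulVec {J K M : Type*} [Fintype K] [AddCommGroup M] [Module ℂ M]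
    (φ : B →ₗ[ℂ] ℂ) (v : Matrix J K B) (y : K → M) :
    contractLeft φ ∘ (v ⊗ᵥ[ℂ] y) = v.map φ •ᵥ y := by
  ext j
  simp [contractLeft, tensorMulVec_apply, matSmul_apply]

theorem exists_dual_comp_inc_eq (hinc : Function.Injective inc) (φ : A →ₗ[ℂ] ℂ) :
    ∃ φ' : B →ₗ[ℂ] ℂ, ∀ a, φ' (inc a) = φ a := by
  obtain ⟨φ', hφ'⟩ := LinearMap.dualMap_surjective_of_injective
    (f := (inc : A →ₐ[ℂ] B).toLinearMap) hinc φ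
  exact ⟨φ', LinearMap.congr_fun hφ'⟩

/-- The comultiplication of `B` with the second tensor factor taken modulo `A`. -/
noncomputable def comulMod (inc : A →ₐc[ℂ] B) : B →ₗ[ℂ] B ⊗[ℂ] (B ⧸ incRange inc) :=
  (incRange inc).mkQ.lTensor B ∘ₗ Coalgebra.comul

theorem comulMod_inc (inc : A →ₐc[ℂ] B) (a : A) : comulMod inc (inc a) = 0 := by
  have h : (incRange inc).mkQ ∘ₗ (inc : A →ₐ[ℂ] B).toLinearMap = 0 :=
    LinearMap.ext (mkQ_inc inc)
  rw [comulMod, LinearMap.comp_apply, comul_inc, ← LinearMap.comp_apply,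
    LinearMap.lTensor_comp_map, h, TensorProduct.map_zero_right, LinearMap.zero_apply]

variable [Fintype I] [DecidableEq I]

namespace IsInhomogeneous

variable (hG : IsInhomogeneous Λ inc p)
include hG

theorem comul_p (i : I) : Coalgebra.comul (R := ℂ) (p i) =
    ((Λ.map inc) ⊗ᵥ[ℂ] p) i + p i ⊗ₜ[ℂ] 1 := by
  simpa [Fintype.sum_sum_type, tensorMulVec_apply] using hG.isRep.comul (Sum.inl i) (Sum.inr ())

theorem comulMod_p (i : I) :
    comulMod inc (p i) = ((Λ.map inc) ⊗ᵥ[ℂ] ((incRange inc).mkQ ∘ p)) i := by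
  simp [comulMod, hG.comul_p, tensorMulVec_apply, -Submodule.mkQ_apply, mkQ_one]

theorem comulMod_vecKron (hΛ : IsRep Λ) (n : I) :
    comulMod inc ∘ (vecKron p (Λ.map inc)).col n =
      ((Λ ⊗ₖ Λ).map inc) ⊗ᵥ[ℂ] ((incRange inc).mkQ ∘ (vecKron p (Λ.map inc)).col n) := by
  have hcomul : Coalgebra.comul (R := ℂ) ∘ (vecKron p (Λ.map inc)).col n =
      outer ((Λ.map inc) ⊗ᵥ[ℂ] p + fun i => p i ⊗ₜ[ℂ] (1 : B))
        ((Λ.map inc) ⊗ᵥ[ℂ] (Λ.map inc).col n) := by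
    ext ij
    simp [vecKron, outer_apply, Bialgebra.comul_mul, hG.comul_p, hΛ.comul_inc, tensorMulVec_apply]
  rw [add_outer, outer_tensorMulVec, outer_tensor_one_tensorMulVec, kroneckerMap_map_inc] at hcomul
  rw [comulMod, LinearMap.coe_comp, Function.comp_assoc, hcomul, lTensor_comp_tensorMulVec_add,
    mkQ_comp_col_map_inc, tensorMulVec_zero, add_zero]
  rfl

theorem comulMod_kronVec (hΛ : IsRep Λ) (n : I) :
    comulMod inc ∘ (kronVec (Λ.map inc) p).col n =
      ((Λ ⊗ₖ Λ).map inc) ⊗ᵥ[ℂ] ((incRange inc).mkQ ∘ (kronVec (Λ.map inc) p).col n) := by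
  have hcomul : Coalgebra.comul (R := ℂ) ∘ (kronVec (Λ.map inc) p).col n =
      outer ((Λ.map inc) ⊗ᵥ[ℂ] (Λ.map inc).col n)
        ((Λ.map inc) ⊗ᵥ[ℂ] p + fun i => p i ⊗ₜ[ℂ] (1 : B)) := by
    ext ij
    simp [kronVec, outer_apply, Bialgebra.comul_mul, hG.comul_p, hΛ.comul_inc, tensorMulVec_apply]
  rw [outer_add, outer_tensorMulVec, outer_tensorMulVec_tensor_one, kroneckerMap_map_inc] at hcomul
  rw [comulMod, LinearMap.coe_comp, Function.comp_assoc, hcomul, lTensor_comp_tensorMulVec_add,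
    mkQ_comp_col_map_inc, tensorMulVec_zero, add_zero]
  rfl

theorem linearIndependent_mkQ (hΛ : IsIrrep Λ) :
    LinearIndependent ℂ ((incRange inc).mkQ ∘ p) := by
  -- Modulo `A` the `p_i` transform under `Δ` by `Λ`, so the coefficients of the linear relations
  -- among them form an invariant subspace.
  set y := (incRange inc).mkQ ∘ p with hy
  rw [linearIndependent_iff_injective_fintypeLinearCombination, ← LinearMap.ker_eq_bot]
  refine (hΛ.eq_bot_or_eq_top_of_vecMul_mem _ fun φ c hc => ?_).resolve_right fun htop => ?_
  · obtain ⟨φ', hφ'⟩ := exists_dual_comp_inc_eq hG.inc_injective φ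
    have hc' : ∑ i, c i • p i ∈ incRange inc := by
      rw [LinearMap.mem_ker, Fintype.linearCombination_apply] at hc
      rw [← (incRange inc).ker_mkQ, LinearMap.mem_ker, map_sum, ← hc]
      exact Finset.sum_congr rfl fun i _ => map_smul _ _ _
    obtain ⟨a, ha⟩ := hc'
    have hsum : ∑ i, c i • (((Λ.map inc) ⊗ᵥ[ℂ] y) i) = 0 := by
      rw [← comulMod_inc inc a]
      refine Eq.trans ?_ (congrArg (comulMod inc) ha.symm)
      simp only [map_sum, map_smul, hG.comulMod_p, hy]
    have hcomp : (Λ.map inc).map φ' = Λ.map φ := Matrix.ext fun i j => hφ' (Λ i j)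
    have hrow := congrFun (mul_matSmul (Matrix.replicateRow Unit c) ((Λ.map inc).map φ') y) ()
    rw [← contractLeft_comp_tensorMulVec] at hrow
    rw [LinearMap.mem_ker, Fintype.linearCombination_apply, ← hcomp]
    refine hrow.trans (Eq.trans ?_ ((congrArg (contractLeft φ') hsum).trans (map_zero _)))
    simp [matSmul_apply]
  · obtain ⟨i, hi⟩ := hG.exists_notMem
    have hpi : Pi.single i 1 ∈ LinearMap.ker (Fintype.linearCombination ℂ y) :=
      htop ▸ Submodule.mem_top
    rw [LinearMap.mem_ker, Fintype.linearCombination_apply_single, one_smul] at hpi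
    exact hi ((Submodule.Quotient.mk_eq_zero (incRange inc)).mp hpi)

end IsInhomogeneous

theorem eq_zero_of_map_mul_vecKron_mem (hp : LinearIndependent ℂ ((incRange inc).mkQ ∘ p))
    (hΛ : IsRep Λ) {J : Type*} {C : Matrix J (I × I) ℂ}
    (hC : ∀ j n, (C.map (algebraMap ℂ B) * vecKron p (Λ.map inc)) j n ∈ incRange inc) : C = 0 := by
  have hp1 : vecKron p (Λ.map inc) * (Λ.map (HopfAlgebra.antipode ℂ)).map inc =
      vecKron p (1 : Matrix I I B) := by
    rw [vecKron_mul, ← Matrix.map_mul, hΛ.mul_map_antipode,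
      Matrix.map_one _ (map_zero _) (map_one _)]
  have hmem : ∀ j r,
      (C.map (algebraMap ℂ B) * vecKron p (1 : Matrix I I B)) j r ∈ incRange inc := fun j r => by
    rw [← hp1, ← Matrix.mul_assoc, Matrix.mul_apply]
    exact Submodule.sum_mem _ fun n _ => mul_inc_mem_incRange (hC j n) _
  ext j ⟨i, r⟩
  refine Fintype.linearIndependent_iff.mp hp (fun i => C j (i, r)) ?_ i
  have hr := (Submodule.Quotient.mk_eq_zero _).mpr (hmem j r)
  rw [← Submodule.mkQ_apply] at hr
  simpa [-Submodule.mkQ_apply, Matrix.mul_apply, Fintype.sum_prod_type, vecKron, Matrix.one_apply,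
    ← Algebra.smul_def] using hr

namespace SatisfiesRelations

variable {R : Matrix (I × I) (I × I) ℂ} {Z : Matrix (I × I) I ℂ} {T : I × I → ℂ}
  (h : SatisfiesRelations Λ inc p R Z T)
include h

theorem mkQ_kronVec (n : I) : (incRange inc).mkQ ∘ (kronVec (Λ.map inc) p).col n =
    R •ᵥ ((incRange inc).mkQ ∘ (vecKron p (Λ.map inc)).col n) := by
  ext ij
  rw [Function.comp_apply, Matrix.col_apply, h.kronVec_eq, Matrix.sub_apply, map_sub,
    Matrix.map_apply (f := inc), mkQ_inc, sub_zero]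
  simp [-Submodule.mkQ_apply, Matrix.mul_apply, matSmul_apply, ← Algebra.smul_def]

theorem isMor_R (hG : IsInhomogeneous Λ inc p) (hΛ : IsIrrep Λ) :
    IsMor (Λ ⊗ₖ Λ) (Λ ⊗ₖ Λ) R := by
  -- Modulo `A` one has `Λ ⊗ p = R (p ⊗ Λ)`, and `Δ` acts on both sides through `Λ ⊗ Λ`.
  set w := fun n => (incRange inc).mkQ ∘ (vecKron p (Λ.map inc)).col n with hw
  have hdefect : ∀ n, ((morDefect (Λ ⊗ₖ Λ) (Λ ⊗ₖ Λ) R).map inc) ⊗ᵥ[ℂ] w n = 0 := fun n => by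
    have hn : comulMod inc ∘ (kronVec (Λ.map inc) p).col n =
        R •ᵥ (comulMod inc ∘ (vecKron p (Λ.map inc)).col n) := by
      ext ij
      rw [Function.comp_apply, Matrix.col_apply, h.kronVec_eq, Matrix.sub_apply, map_sub,
        Matrix.map_apply (f := inc), comulMod_inc, sub_zero]
      simp [Matrix.mul_apply, matSmul_apply, ← Algebra.smul_def]
    rw [hG.comulMod_vecKron hΛ.isRep, hG.comulMod_kronVec hΛ.isRep, h.mkQ_kronVec] at hn
    rw [map_morDefect_tensorMulVec, hn, sub_self]
  rw [isMor_iff_morDefect_eq_zero]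
  set X := morDefect (Λ ⊗ₖ Λ) (Λ ⊗ₖ Λ) R
  have hX : ∀ φ : A →ₗ[ℂ] ℂ, X.map φ = 0 := fun φ => by
    obtain ⟨φ', hφ'⟩ := exists_dual_comp_inc_eq hG.inc_injective φ
    have hcomp : (X.map inc).map φ' = X.map φ := Matrix.ext fun _ _ => hφ' _
    refine eq_zero_of_map_mul_vecKron_mem (hG.linearIndependent_mkQ hΛ) hΛ.isRep fun ij n => ?_
    rw [← (incRange inc).ker_mkQ, LinearMap.mem_ker]
    have hn := congrFun (contractLeft_comp_tensorMulVec φ' (X.map inc) (w n)) ij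
    rw [hdefect, hcomp] at hn
    simpa [-Submodule.mkQ_apply, hw, Matrix.mul_apply, matSmul_apply, ← Algebra.smul_def]
      using hn.symm
  ext ij st
  exact (Module.forall_dual_apply_eq_zero_iff ℂ _).mp fun φ => congrFun₂ (hX φ) ij st

end SatisfiesRelations

end Translations

section Reality

variable {I A B : Type*} [Ring A] [HopfAlgebra ℂ A] [StarRing A]
  [StarModule ℂ A] [Ring B] [Bialgebra ℂ B] [StarRing B] [StarModule ℂ B] {Λ : Matrix I I A}
  {inc : A →ₐc[ℂ] B} {p : I → B} {R : Matrix (I × I) (I × I) ℂ} {Z : Matrix (I × I) I ℂ}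
  {T : I × I → ℂ}

theorem IsStarCompatible.swapConj_map_inc (hs : IsStarCompatible inc p) {n : Type*}
    (X : Matrix (I × I) n A) : swapConj (X.map inc) = (swapConj X).map inc :=
  Matrix.ext fun _ _ => (hs.inc_star _).symm

variable [Fintype I]

theorem swapConj_map_mul {n : Type*} (P : Matrix (I × I) (I × I) ℂ) (X : Matrix (I × I) n B) :
    swapConj (P.map (algebraMap ℂ B) * X) =
      (swapConjSq P).map (algebraMap ℂ B) * swapConj X := by
  ext ij l
  simp only [swapConj, swapConjSq, Matrix.submatrix_apply, Matrix.map_apply, Matrix.mul_apply,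
    star_sum, star_mul, ← algebraMap_star_comm, Algebra.commutes, id]
  exact Fintype.sum_equiv (Equiv.prodComm I I) _ _ fun _ => rfl

theorem star_mulVec_comp_swap (P : Matrix (I × I) (I × I) ℂ) (t : I × I → ℂ) :
    star (P.mulVec t) ∘ Prod.swap = (swapConjSq P).mulVec (star t ∘ Prod.swap) := by
  ext ij
  simp only [swapConjSq, Matrix.mulVec, dotProduct, Function.comp_apply, Pi.star_apply, star_sum,
    star_mul', Matrix.submatrix_apply, Matrix.map_apply]
  exact Fintype.sum_equiv (Equiv.prodComm I I) _ _ fun _ => rfl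

theorem star_kronecker_mulVec (hsΛ : ∀ i j, star (Λ i j) = Λ i j) (t : I × I → ℂ) (ij : I × I) :
    star ((Λ ⊗ₖ Λ).mulVec (algebraMap ℂ A ∘ t) ij.swap) =
      (Λ ⊗ₖ Λ).mulVec (algebraMap ℂ A ∘ (star t ∘ Prod.swap)) ij := by
  simp only [Matrix.mulVec, dotProduct, Function.comp_apply, Pi.star_apply, star_sum, star_mul,
    Matrix.kroneckerMap_apply, hsΛ, ← algebraMap_star_comm, Algebra.commutes]
  exact Fintype.sum_equiv (Equiv.prodComm I I) _ _ fun _ => rfl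

theorem swapConj_morDefect (hsΛ : ∀ i j, star (Λ i j) = Λ i j) (Z : Matrix (I × I) I ℂ) :
    swapConj (morDefect Λ (Λ ⊗ₖ Λ) Z) = morDefect Λ (Λ ⊗ₖ Λ) (swapConj Z) := by
  ext ij l
  simp only [swapConj, morDefect, Matrix.submatrix_apply, Matrix.map_apply, Matrix.mul_apply,
    Matrix.sub_apply, star_sub, star_sum, star_mul, ← algebraMap_star_comm, Algebra.commutes,
    Matrix.kroneckerMap_apply, hsΛ, id]
  exact congrArg _ (Fintype.sum_equiv (Equiv.prodComm I I) _ _ fun _ => rfl)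

variable [DecidableEq I]

namespace SatisfiesRelations

variable (h : SatisfiesRelations Λ inc p R Z T) (hs : IsStarCompatible inc p)
  (hsΛ : ∀ i j, star (Λ i j) = Λ i j)
include h hs hsΛ

theorem swapConjSq_sub_mul_vecKron (hR : IsMor (Λ ⊗ₖ Λ) (Λ ⊗ₖ Λ) R) :
    (swapConjSq R - R).map (algebraMap ℂ B) * vecKron p (Λ.map inc) =
      (-morDefect Λ (Λ ⊗ₖ Λ) (R * Z + swapConj Z)).map inc := by
  have hconj := congrArg swapConj h.commutation
  have hadd : ∀ X Y : Matrix (I × I) I B, swapConj (X + Y) = swapConj X + swapConj Y :=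
    fun _ _ => Matrix.ext fun _ _ => star_add _ _
  have hΛp : swapConj (kronVec (Λ.map inc) p) = vecKron p (Λ.map inc) := by
    ext
    simp [swapConj, vecKron, kronVec, ← hs.inc_star, hs.star_p, hsΛ]
  rw [hadd, swapConj_map_mul, hΛp, hs.swapConj_map_inc, swapConj_morDefect hsΛ,
    swapConj_vecKron hs.star_p (fun i l => by rw [Matrix.map_apply, ← hs.inc_star, hsΛ]),
    h.kronVec_eq, hR.map_mul_morDefect] at hconj
  rw [morDefect_add, Matrix.map_sub _ (map_sub _), Matrix.sub_mul, sub_eq_iff_eq_add,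
    eq_sub_of_add_eq hconj.symm]
  ext
  simp only [Matrix.sub_apply, Matrix.map_apply, neg_add_rev, Matrix.add_apply, Matrix.neg_apply,
    map_add, map_neg]
  abel

theorem relator_star_comp_swap (hmor : IsMor (Λ ⊗ₖ Λ) (Λ ⊗ₖ Λ) R) (hR : swapConjSq R = R)
    (hZ : (R - 1) * swapConj Z = (R - 1) * Z) : relator R Z (star T ∘ Prod.swap) p =
      inc ∘ (Λ ⊗ₖ Λ).mulVec (algebraMap ℂ A ∘ (R - 1).mulVec (star T ∘ Prod.swap)) := by
  ext kl
  have hstar := antihom_relator (starRingEquiv : B ≃+* Bᵐᵒᵖ).toRingHom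
    (fun c b => congrArg MulOpposite.op (star_smul c b)) R Z T p kl
  rw [hR, relator_congr hZ rfl, h.quadratic_of_isMor hmor] at hstar
  have hone : swapConjSq (R - 1) = R - 1 := by
    rw [swapConjSq_sub_one, hR]
  rw [← hone, ← star_mulVec_comp_swap, Function.comp_apply,
    ← star_kronecker_mulVec hsΛ, hs.inc_star]
  simpa [hs.star_p] using hstar.symm

theorem isReal (hG : IsInhomogeneous Λ inc p) (hΛ : IsIrrep Λ)
    (hmor : ∀ M : Matrix (I × I) I ℂ, IsMor Λ (Λ ⊗ₖ Λ) M → M = 0)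
    (hinv : ∀ t : I × I → ℂ, (Λ ⊗ₖ Λ).mulVec (algebraMap ℂ A ∘ t) = algebraMap ℂ A ∘ t →
      (R + 1).mulVec t = 0 → t = 0) : IsReal R Z T := by
  have hvec := h.swapConjSq_sub_mul_vecKron hs hsΛ (h.isMor_R hG hΛ)
  have hR : swapConjSq R = R := sub_eq_zero.mp <|
    eq_zero_of_map_mul_vecKron_mem (hG.linearIndependent_mkQ hΛ) hΛ.isRep fun ij n => by
      rw [hvec]
      exact inc_mem_incRange inc _
  have hRZ : R * Z + swapConj Z = 0 := hmor _ <| isMor_iff_morDefect_eq_zero.mpr <| by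
    rw [hR, sub_self, Matrix.map_zero _ (map_zero _), Matrix.zero_mul] at hvec
    refine neg_eq_zero.mp (Matrix.map_injective hG.inc_injective (hvec.symm.trans ?_))
    exact (Matrix.map_zero _ (map_zero inc)).symm
  have hZ : (R - 1) * swapConj Z = (R - 1) * Z := by
    rw [← neg_eq_of_add_eq_zero_right hRZ, Matrix.mul_neg, ← Matrix.mul_assoc, ← Matrix.neg_mul,
      sub_mul, h.R_sq, one_mul, neg_sub]
  refine ⟨hR, hZ, ?_⟩
  set T' := star T ∘ Prod.swap
  have hsub := relator_sub_relator R Z T' T p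
  rw [h.relator_star_comp_swap hs hsΛ (h.isMor_R hG hΛ) hR hZ,
    h.quadratic_of_isMor (h.isMor_R hG hΛ)] at hsub
  refine sub_eq_zero.mp ((Matrix.mulVec_sub _ _ _).symm.trans (hinv _ ?_ ?_))
  · ext kl
    apply hG.inc_injective
    have hkl := congrFun hsub kl
    have hcomp : (algebraMap ℂ A ∘ (R - 1).mulVec (T' - T)) =
        algebraMap ℂ A ∘ (R - 1).mulVec T' - algebraMap ℂ A ∘ (R - 1).mulVec T := by
      rw [Matrix.mulVec_sub]
      exact funext fun _ => map_sub _ _ _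
    rw [hcomp, Matrix.mulVec_sub, Pi.sub_apply, map_sub, ← hcomp]
    exact hkl.trans (AlgHomClass.commutes inc _).symm
  · rw [Matrix.mulVec_mulVec, h.add_one_mul_sub_one, Matrix.zero_mulVec]

end SatisfiesRelations

end Reality

section Filtration

variable {k B C I : Type*} [CommRing k] [Ring B] [Algebra k B] [Ring C] [Algebra k C]

/-- The span in `B ⊗ C` of the tensors `b ⊗ c` with `b ∈ U` and `c ∈ W`. -/
def tensorSubmodule (U : Submodule k B) (W : Submodule k C) : Submodule k (B ⊗[k] C) :=
  Submodule.map₂ (TensorProduct.mk k B C) U W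

theorem tmul_mem_tensorSubmodule {U : Submodule k B} {W : Submodule k C} {b : B} {c : C}
    (hb : b ∈ U) (hc : c ∈ W) : b ⊗ₜ[k] c ∈ tensorSubmodule U W :=
  Submodule.apply_mem_map₂ _ hb hc

theorem tensorMulVec_mem_tensorSubmodule {J K : Type*} [Fintype K] {U : Submodule k B}
    {W : Submodule k C} {v : Matrix J K B} {y : K → C} (hv : ∀ j l, v j l ∈ U) (hy : ∀ l, y l ∈ W)
    (j : J) : (v ⊗ᵥ[k] y) j ∈ tensorSubmodule U W :=
  Submodule.sum_mem _ fun l _ => tmul_mem_tensorSubmodule (hv j l) (hy l)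

theorem tensorSubmodule_mono {U U' : Submodule k B} {W W' : Submodule k C} (hU : U ≤ U')
    (hW : W ≤ W') : tensorSubmodule U W ≤ tensorSubmodule U' W' :=
  Submodule.map₂_le_map₂ hU hW

theorem tensorSubmodule_mul_le (U U' : Submodule k B) (W W' : Submodule k C) :
    tensorSubmodule U W * tensorSubmodule U' W' ≤ tensorSubmodule (U * U') (W * W') := by
  rw [tensorSubmodule, tensorSubmodule, Submodule.map₂_eq_span_image2,
    Submodule.map₂_eq_span_image2, Submodule.span_mul_span, Submodule.span_le]
  rintro _ ⟨_, ⟨b, hb, c, hc, rfl⟩, _, ⟨b', hb', c', hc', rfl⟩, rfl⟩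
  change b ⊗ₜ[k] c * b' ⊗ₜ[k] c' ∈ tensorSubmodule _ _
  rw [Algebra.TensorProduct.tmul_mul_tmul]
  exact tmul_mem_tensorSubmodule (Submodule.mul_mem_mul hb hb') (Submodule.mul_mem_mul hc hc')

theorem tmul_one_mul_mem_tensorSubmodule_top {W : Submodule k C} (b : B) {z : B ⊗[k] C}
    (hz : z ∈ tensorSubmodule ⊤ W) : (b ⊗ₜ[k] 1) * z ∈ tensorSubmodule ⊤ W := by
  have h := tensorSubmodule_mul_le _ _ _ _
    (Submodule.mul_mem_mul (tmul_mem_tensorSubmodule (U := ⊤) (b := b) trivial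
      (Submodule.one_le.mp le_rfl)) hz)
  rw [one_mul] at h
  exact tensorSubmodule_mono le_top le_rfl h

variable (k) in
/-- The elements of degree less than `n` in the generators `x`. -/
def degreeLT (x : I → C) : ℕ → Submodule k C
  | 0 => ⊥
  | n + 1 => Submodule.span k (insert 1 (Set.range x)) ^ n

theorem degreeLT_one (x : I → C) : degreeLT k x 1 = Submodule.span k {1} :=
  (pow_zero _).trans Submodule.one_eq_span

theorem degreeLT_two (x : I → C) : degreeLT k x 2 = Submodule.span k (insert 1 (Set.range x)) :=
  pow_one _

theorem one_mem_degreeLT_two (x : I → C) : 1 ∈ degreeLT k x 2 :=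
  degreeLT_two (k := k) x ▸ Submodule.subset_span (Set.mem_insert _ _)

theorem mem_degreeLT_two (x : I → C) (i : I) : x i ∈ degreeLT k x 2 :=
  degreeLT_two (k := k) x ▸ Submodule.subset_span (Set.mem_insert_of_mem _ ⟨i, rfl⟩)

theorem degreeLT_two_mul (x : I → C) (n : ℕ) :
    degreeLT k x 2 * degreeLT k x (n + 1) = degreeLT k x (n + 2) := by
  rw [degreeLT_two]
  exact (pow_succ' _ _).symm

theorem degreeLT_two_mul_le (x : I → C) (n : ℕ) :
    degreeLT k x 2 * degreeLT k x n ≤ degreeLT k x (n + 1) := by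
  cases n with
  | zero => simp [degreeLT]
  | succ n => exact (degreeLT_two_mul x n).le

theorem mul_mem_degreeLT {x : I → C} {n : ℕ} {a c : C} (ha : a ∈ degreeLT k x 2)
    (hc : c ∈ degreeLT k x n) : a * c ∈ degreeLT k x (n + 1) :=
  degreeLT_two_mul_le x n (Submodule.mul_mem_mul ha hc)

theorem degreeLT_mono (x : I → C) : Monotone (degreeLT k x) :=
  monotone_nat_of_le_succ fun _ c hc => one_mul c ▸ mul_mem_degreeLT (one_mem_degreeLT_two x) hc

theorem degreeLT_le {x : I → C} {N : ℕ → Submodule k C} (hone : 1 ∈ N 1)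
    (hmono : ∀ n, ∀ c ∈ degreeLT k x (n + 1), c ∈ N (n + 1) → c ∈ N (n + 2))
    (hmul : ∀ n i, ∀ c ∈ degreeLT k x (n + 1), c ∈ N (n + 1) → x i * c ∈ N (n + 2)) (n : ℕ) :
    degreeLT k x n ≤ N n := by
  cases n with
  | zero => exact bot_le
  | succ n =>
    induction n with
    | zero => simpa [degreeLT_one] using hone
    | succ n ih =>
      rw [← degreeLT_two_mul, Submodule.mul_le]
      intro a ha c hc
      suffices degreeLT k x 2 ≤ (N (n + 2)).comap (LinearMap.mulRight k c) from this ha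
      rw [degreeLT_two, Submodule.span_le, Set.insert_subset_iff, Set.range_subset_iff]
      exact ⟨by simpa using hmono n c hc (ih hc), fun i => hmul n i c hc (ih hc)⟩

theorem exists_mem_degreeLT {x : I → C} (hx : Algebra.adjoin k (Set.range x) = ⊤) (c : C) :
    ∃ n, c ∈ degreeLT k x (n + 1) := by
  induction (hx ▸ trivial : c ∈ Algebra.adjoin k (Set.range x)) using Algebra.adjoin_induction with
  | mem c hc =>
    obtain ⟨i, rfl⟩ := hc
    exact ⟨1, mem_degreeLT_two x i⟩
  | algebraMap r =>
    refine ⟨0, ?_⟩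
    rw [degreeLT_one, Algebra.algebraMap_eq_smul_one]
    exact Submodule.smul_mem _ _ (Submodule.mem_span_singleton_self 1)
  | add c d _ _ hc hd =>
    obtain ⟨m, hm⟩ := hc
    obtain ⟨n, hn⟩ := hd
    exact ⟨max m n, add_mem (degreeLT_mono x (by omega) hm) (degreeLT_mono x (by omega) hn)⟩
  | mul c d _ _ hc hd =>
    obtain ⟨m, hm⟩ := hc
    obtain ⟨n, hn⟩ := hd
    exact ⟨m + n, (pow_add (Submodule.span k (insert 1 (Set.range x))) m n).ge
      (Submodule.mul_mem_mul hm hn)⟩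

end Filtration

section Coaction

variable {I A B C : Type*} [Ring A] [HopfAlgebra ℂ A] [Ring B] [Bialgebra ℂ B] [Ring C]
  [Algebra ℂ C] {Λ : Matrix I I A} {inc : A →ₐc[ℂ] B} {p : I → B} {x : I → C}

/-- The subspace `A ⊗ C + B ⊗ C_n` of `B ⊗ C`, with `C_n` the elements of degree less than `n`. -/
def lowerTerms (inc : A →ₐc[ℂ] B) (x : I → C) (n : ℕ) : Submodule ℂ (B ⊗[ℂ] C) :=
  tensorSubmodule (incRange inc) ⊤ ⊔ tensorSubmodule ⊤ (degreeLT ℂ x n)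

theorem lowerTerms_mono (inc : A →ₐc[ℂ] B) (x : I → C) : Monotone (lowerTerms inc x) :=
  fun _ _ h => sup_le_sup_left (tensorSubmodule_mono le_rfl (degreeLT_mono x h)) _

theorem mul_mem_lowerTerms {n : ℕ} {u z : B ⊗[ℂ] C}
    (hu : u ∈ tensorSubmodule (incRange inc) (degreeLT ℂ x 2)) (hz : z ∈ lowerTerms inc x (n - 1)) :
    u * z ∈ lowerTerms inc x n := by
  obtain ⟨a, ha, b, hb, rfl⟩ := Submodule.mem_sup.mp hz
  have hua := tensorSubmodule_mul_le _ _ _ _ (Submodule.mul_mem_mul hu ha)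
  have hub := tensorSubmodule_mul_le _ _ _ _ (Submodule.mul_mem_mul hu hb)
  rw [mul_add]
  refine add_mem (Submodule.mem_sup_left (tensorSubmodule_mono incRange_mul_self le_top hua))
    (Submodule.mem_sup_right (tensorSubmodule_mono le_top ?_ hub))
  cases n with
  | zero => simp [degreeLT]
  | succ n => exact degreeLT_two_mul_le x n

variable [Fintype I]

/-- The family `Λ ⊗ y + p ⊗ 1` to which an inhomogeneous transformation sends the coordinates
`y`. -/
noncomputable def transform (Λ : Matrix I I A) (inc : A →ₐc[ℂ] B) (p : I → B) (y : I → C) :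
    I → B ⊗[ℂ] C :=
  (Λ.map inc) ⊗ᵥ[ℂ] y + fun i => p i ⊗ₜ[ℂ] 1

theorem tensorMulVec_mem {J : Type*} (M : Matrix J I A) (x : I → C) (j : J) :
    ((M.map inc) ⊗ᵥ[ℂ] x) j ∈ tensorSubmodule (incRange inc) (degreeLT ℂ x 2) :=
  tensorMulVec_mem_tensorSubmodule (fun _ _ => inc_mem_incRange inc _) (mem_degreeLT_two x) j

variable {Ψ : C →ₐ[ℂ] B ⊗[ℂ] C} (hΨ : Ψ ∘ x = transform Λ inc p x)
include hΨ

theorem map_mem_tensorSubmodule_degreeLT {n : ℕ} {c : C} (hc : c ∈ degreeLT ℂ x n) :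
    Ψ c ∈ tensorSubmodule ⊤ (degreeLT ℂ x n) := by
  refine degreeLT_le (N := fun n => (tensorSubmodule ⊤ (degreeLT ℂ x n)).comap Ψ.toLinearMap)
    ?_ (fun n c _ ih => ?_) (fun n i c _ ih => ?_) n hc
  · rw [Submodule.mem_comap, AlgHom.toLinearMap_apply, map_one, Algebra.TensorProduct.one_def]
    exact tmul_mem_tensorSubmodule trivial (Submodule.one_le.mp le_rfl)
  · exact tensorSubmodule_mono le_rfl (degreeLT_mono x (Nat.le_succ _)) ih
  · have hx : Ψ (x i) = transform Λ inc p x i := congrFun hΨ i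
    have hL := tensorSubmodule_mul_le _ _ _ _
      (Submodule.mul_mem_mul (tensorMulVec_mem (inc := inc) Λ x i) ih)
    rw [Submodule.mem_comap, AlgHom.toLinearMap_apply, map_mul, hx, transform,
      Pi.add_apply, add_mul]
    exact add_mem (tensorSubmodule_mono le_top (degreeLT_two_mul_le x _) hL)
      (tensorSubmodule_mono le_rfl (degreeLT_mono x (Nat.le_succ _))
        (tmul_one_mul_mem_tensorSubmodule_top _ ih))

theorem map_mem_lowerTerms {n : ℕ} {c : C} (hc : c ∈ degreeLT ℂ x n) :
    Ψ c ∈ lowerTerms inc x (n - 1) := by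
  refine degreeLT_le (N := fun n => (lowerTerms inc x (n - 1)).comap Ψ.toLinearMap)
    ?_ (fun n c _ ih => ?_) (fun n i c hc ih => ?_) n hc
  · rw [Submodule.mem_comap, AlgHom.toLinearMap_apply, map_one, Algebra.TensorProduct.one_def]
    exact Submodule.mem_sup_left (tmul_mem_tensorSubmodule (one_mem_incRange inc) trivial)
  · exact lowerTerms_mono inc x (Nat.le_succ _) ih
  · have hx : Ψ (x i) = transform Λ inc p x i := congrFun hΨ i
    rw [Submodule.mem_comap, AlgHom.toLinearMap_apply, map_mul, hx, transform,
      Pi.add_apply, add_mul]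
    exact add_mem (mul_mem_lowerTerms (tensorMulVec_mem Λ x i) ih) (Submodule.mem_sup_right
      (tmul_one_mul_mem_tensorSubmodule_top _ (map_mem_tensorSubmodule_degreeLT hΨ hc)))

end Coaction

section TwistedDerivative

variable {I k C D : Type*} [Fintype I] [DecidableEq I] [CommRing k] [Ring C] [Algebra k C]
  [Ring D] [Algebra k D]

/-- The derivatives of `x_i c` with respect to the generators, obtained from those of `c` by a
Leibniz rule in which the derivations move past `x_i` by means of `R`. -/
def leibniz (R : Matrix (I × I) (I × I) k) (x : I → C) (i : I) (c : C) (d : I → C) : I → C :=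
  fun s => (Pi.single i c : I → C) s + ∑ m, ∑ t, R (i, m) (s, t) • (x t * d m)

theorem sum_mul_map_leibniz (R : Matrix (I × I) (I × I) k) (x : I → C) (i : I) (c : C) (d : I → C)
    (u : I → D) (φ : C →ₗ[k] D) : ∑ s, u s * φ (leibniz R x i c d s) =
      u i * φ c + ∑ m, ∑ st : I × I, R (i, m) st • (u st.1 * φ (x st.2 * d m)) := by
  simp only [leibniz, map_add, mul_add, Finset.sum_add_distrib, map_sum, map_smul, Finset.mul_sum,
    mul_smul_comm, Fintype.sum_prod_type]
  refine congrArg₂ (· + ·) ?_ Finset.sum_comm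
  rw [Fintype.sum_eq_single i fun s hs => by simp [hs], Pi.single_eq_same]

theorem leibniz_mem {R : Matrix (I × I) (I × I) k} {x : I → C} {n : ℕ} {c : C} {d : I → C}
    (hc : c ∈ degreeLT k x (n + 1)) (hd : ∀ s, d s ∈ degreeLT k x n) (i s : I) :
    leibniz R x i c d s ∈ degreeLT k x (n + 1) := by
  refine add_mem ?_ (Submodule.sum_mem _ fun m _ => Submodule.sum_mem _ fun t _ =>
    Submodule.smul_mem _ _ (mul_mem_degreeLT (mem_degreeLT_two x t) (hd m)))
  obtain rfl | hs := eq_or_ne s i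
  · rwa [Pi.single_eq_same]
  · rw [Pi.single_eq_of_ne hs]
    exact zero_mem _

theorem sum_mul_leibniz_sub_mem {R : Matrix (I × I) (I × I) k} {x : I → C}
    (hx : ∀ kl, matSmul (R - 1) (outer x x) kl ∈ degreeLT k x 2) {n : ℕ} {c : C} {d : I → C}
    (hd : ∀ s, d s ∈ degreeLT k x n) (hcd : ∑ s, x s * d s - (n : k) • c ∈ degreeLT k x n) (i : I) :
    ∑ s, x s * leibniz R x i c d s - ((n + 1 : ℕ) : k) • (x i * c) ∈ degreeLT k x (n + 1) := by
  have hsum := sum_mul_map_leibniz R x i c d x LinearMap.id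
  have hR : ∀ m, ∑ st : I × I, R (i, m) st • (x st.1 * (x st.2 * d m)) =
      ((R - 1) •ᵥ outer x x) (i, m) * d m + x i * (x m * d m) := fun m => by
    rw [sub_matSmul, one_matSmul, Pi.sub_apply, sub_mul, outer_apply, mul_assoc, sub_add_cancel]
    simp [matSmul_apply, outer_apply, Finset.sum_mul, mul_assoc]
  simp only [LinearMap.id_apply, hR, Finset.sum_add_distrib, ← Finset.mul_sum] at hsum
  have h : ∑ s, x s * leibniz R x i c d s - ((n + 1 : ℕ) : k) • (x i * c) =
      ∑ m, ((R - 1) •ᵥ outer x x) (i, m) * d m + x i * (∑ s, x s * d s - (n : k) • c) := by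
    rw [hsum, mul_sub, mul_smul_comm, Nat.cast_succ, add_smul, one_smul]
    abel
  rw [h]
  exact add_mem (Submodule.sum_mem _ fun m _ => mul_mem_degreeLT (hx _) (hd m))
    (mul_mem_degreeLT (mem_degreeLT_two x i) hcd)

variable {A B : Type*} [Ring A] [HopfAlgebra ℂ A] [Ring B] [Bialgebra ℂ B] [Algebra ℂ C]
  {Λ : Matrix I I A} {inc : A →ₐc[ℂ] B} {p : I → B} {R : Matrix (I × I) (I × I) ℂ}
  {Z : Matrix (I × I) I ℂ} {T : I × I → ℂ} {x : I → C} {Ψ : C →ₐ[ℂ] B ⊗[ℂ] C}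

theorem SatisfiesRelations.outer_tensorMulVec_tensor_one (h : SatisfiesRelations Λ inc p R Z T)
    (y : I → C) : outer ((Λ.map inc) ⊗ᵥ[ℂ] y) (fun i => p i ⊗ₜ[ℂ] (1 : C)) =
      R •ᵥ outer (fun i => p i ⊗ₜ[ℂ] (1 : C)) ((Λ.map inc) ⊗ᵥ[ℂ] y)
        - ((R.map (algebraMap ℂ A) * morDefect Λ (Λ ⊗ₖ Λ) Z).map inc) ⊗ᵥ[ℂ] y := by
  rw [InhomQG.outer_tensorMulVec_tensor_one, h.kronVec_eq, sub_tensorMulVec, map_mul_tensorMulVec,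
    outer_tensor_one_tensorMulVec]

theorem tensorMulVec_mul_tmul_one_mul_map_sub_mem (h : SatisfiesRelations Λ inc p R Z T)
    (hΨ : Ψ ∘ x = transform Λ inc p x) {n : ℕ} {c : C} (hc : c ∈ degreeLT ℂ x n) (i m : I) :
    ((Λ.map inc) ⊗ᵥ[ℂ] x) i * p m ⊗ₜ[ℂ] 1 * Ψ c -
      ∑ st : I × I, R (i, m) st • (p st.1 ⊗ₜ[ℂ] 1 * Ψ (x st.2 * c)) ∈ lowerTerms inc x n := by
  set L := (Λ.map inc) ⊗ᵥ[ℂ] x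
  set P : I → B ⊗[ℂ] C := fun i => p i ⊗ₜ[ℂ] 1
  set N := ((R.map (algebraMap ℂ A) * morDefect Λ (Λ ⊗ₖ Λ) Z).map inc) ⊗ᵥ[ℂ] x
  have hx : ∀ i, Ψ (x i) = L i + P i := congrFun hΨ
  have hLP : L i * P m = (R •ᵥ outer P L) (i, m) - N (i, m) :=
    congrFun (h.outer_tensorMulVec_tensor_one x) (i, m)
  have heq : L i * P m * Ψ c - ∑ st : I × I, R (i, m) st • (P st.1 * Ψ (x st.2 * c)) =
      -(N (i, m) * Ψ c + ∑ st : I × I, R (i, m) st • (P st.1 * (P st.2 * Ψ c))) := by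
    simp only [hLP, map_mul, hx, matSmul_apply, outer_apply, add_mul, mul_add, smul_add,
      Finset.sum_add_distrib, sub_mul, Finset.sum_mul, smul_mul_assoc, mul_assoc]
    abel
  have hPP : ∀ s t, P s * (P t * Ψ c) ∈ tensorSubmodule ⊤ (degreeLT ℂ x n) := fun s t =>
    tmul_one_mul_mem_tensorSubmodule_top _
      (tmul_one_mul_mem_tensorSubmodule_top _ (map_mem_tensorSubmodule_degreeLT hΨ hc))
  change L i * P m * Ψ c - ∑ st : I × I, R (i, m) st • (P st.1 * Ψ (x st.2 * c)) ∈ _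
  rw [heq]
  exact neg_mem (add_mem (mul_mem_lowerTerms (tensorMulVec_mem _ x _) (map_mem_lowerTerms hΨ hc))
    (Submodule.mem_sup_right
      (Submodule.sum_mem _ fun st _ => Submodule.smul_mem _ _ (hPP st.1 st.2))))

theorem map_mul_sub_sum_leibniz_mem (h : SatisfiesRelations Λ inc p R Z T)
    (hΨ : Ψ ∘ x = transform Λ inc p x) {n : ℕ} {c : C} {d : I → C}
    (hd : ∀ s, d s ∈ degreeLT ℂ x n)
    (hcd : Ψ c - ∑ s, p s ⊗ₜ[ℂ] 1 * Ψ (d s) ∈ lowerTerms inc x (n - 1)) (i : I) :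
    Ψ (x i * c) - ∑ s, p s ⊗ₜ[ℂ] 1 * Ψ (leibniz R x i c d s) ∈ lowerTerms inc x n := by
  set L := (Λ.map inc) ⊗ᵥ[ℂ] x
  set P : I → B ⊗[ℂ] C := fun i => p i ⊗ₜ[ℂ] 1
  have hx : Ψ (x i) = L i + P i := congrFun hΨ i
  have heq : Ψ (x i * c) - ∑ s, P s * Ψ (leibniz R x i c d s) =
      L i * (Ψ c - ∑ s, P s * Ψ (d s)) + ∑ m, (L i * P m * Ψ (d m) -
        ∑ st : I × I, R (i, m) st • (P st.1 * Ψ (x st.2 * d m))) := by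
    have hsum := sum_mul_map_leibniz R x i c d P Ψ.toLinearMap
    simp only [AlgHom.toLinearMap_apply] at hsum
    rw [hsum, map_mul, hx, Finset.sum_sub_distrib, mul_sub, Finset.mul_sum]
    simp only [mul_assoc, add_mul]
    abel
  rw [heq]
  exact add_mem (mul_mem_lowerTerms (tensorMulVec_mem Λ x i) hcd)
    (Submodule.sum_mem _ fun m _ => tensorMulVec_mul_tmul_one_mul_map_sub_mem h hΨ (hd m) i m)

end TwistedDerivative

section Contraction

variable {I A B C : Type*} [Ring A] [HopfAlgebra ℂ A] [Ring B] [Bialgebra ℂ B] [Ring C]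
  [Algebra ℂ C] {inc : A →ₐc[ℂ] B} {x : I → C} {n : ℕ}

theorem exists_contract_antipode (hinc : Function.Injective inc) :
    ∃ θ : B ⊗[ℂ] B →ₗ[ℂ] B, (∀ b z, θ (b ⊗ₜ[ℂ] 1 * z) = b * θ z) ∧
      (∀ z ∈ tensorSubmodule (incRange inc) ⊤, θ z ∈ incRange inc) ∧
      ∀ a, θ (Coalgebra.comul (R := ℂ) (inc a)) = algebraMap ℂ B (Coalgebra.counit (R := ℂ) a) := by
  obtain ⟨π, hπ⟩ := (inc : A →ₐ[ℂ] B).toLinearMap.exists_leftInverse_of_injective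
    (LinearMap.ker_eq_bot.mpr hinc)
  have hπ' : ∀ a, π (inc a) = a := LinearMap.congr_fun hπ
  let ψ : B →ₗ[ℂ] B := (inc : A →ₐ[ℂ] B).toLinearMap ∘ₗ HopfAlgebra.antipode ℂ ∘ₗ π
  refine ⟨LinearMap.mul' ℂ B ∘ₗ ψ.lTensor B, fun b z => ?_, fun z hz => ?_, fun a => ?_⟩
  · induction z with
    | zero => simp
    | tmul b' b'' => simp [mul_assoc]
    | add z z' hz hz' => rw [mul_add, map_add, map_add, hz, hz', mul_add]
  · suffices tensorSubmodule (incRange inc) ⊤ ≤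
        (incRange inc).comap (LinearMap.mul' ℂ B ∘ₗ ψ.lTensor B) from this hz
    exact Submodule.map₂_le.mpr fun b hb b' _ => mul_inc_mem_incRange hb _
  · have hS := congrArg inc (HopfAlgebra.mul_antipode_lTensor_comul_apply (R := ℂ) a)
    rw [AlgHomClass.commutes] at hS
    rw [← hS, comul_inc]
    induction Coalgebra.comul (R := ℂ) a with
    | zero => simp
    | tmul a a' => simp [ψ, hπ']
    | add z z' hz hz' => simp only [map_add, hz, hz']

/-- The contraction `b ⊗ c ↦ g(c) b`. -/
noncomputable def contractRight (g : C →ₗ[ℂ] ℂ) : B ⊗[ℂ] C →ₗ[ℂ] B :=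
  (TensorProduct.rid ℂ B).toLinearMap ∘ₗ g.lTensor B

theorem contractRight_mem {U : Submodule ℂ B} {g : C →ₗ[ℂ] ℂ}
    (hg : ∀ c ∈ degreeLT ℂ x n, g c = 0) {z : B ⊗[ℂ] C}
    (hz : z ∈ tensorSubmodule U ⊤ ⊔ tensorSubmodule ⊤ (degreeLT ℂ x n)) :
    contractRight g z ∈ U := by
  suffices tensorSubmodule U ⊤ ⊔ tensorSubmodule ⊤ (degreeLT ℂ x n) ≤ U.comap (contractRight g)
    from this hz
  refine sup_le (Submodule.map₂_le.mpr fun b hb c _ => ?_)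
    (Submodule.map₂_le.mpr fun b _ c hc => ?_)
  · simpa [contractRight] using U.smul_mem (g c) hb
  · simp [contractRight, hg c hc]

theorem counit_contractRight (g : C →ₗ[ℂ] ℂ) (z : B ⊗[ℂ] C) :
    Coalgebra.counit (R := ℂ) (contractRight g z) = g (contractLeft Coalgebra.counit z) := by
  induction z with
  | zero => simp
  | tmul b c => simp [contractRight, contractLeft, mul_comm]
  | add z z' hz hz' => simp only [map_add, hz, hz']

theorem comul_contractRight {Ψ : C →ₗ[ℂ] B ⊗[ℂ] C} {c : C}
    (hc : Ψ.lTensor B (Ψ c) = TensorProduct.assoc ℂ B B C (Coalgebra.comul.rTensor C (Ψ c)))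
    (g : C →ₗ[ℂ] ℂ) :
    Coalgebra.comul (contractRight g (Ψ c)) = (contractRight g ∘ₗ Ψ).lTensor B (Ψ c) := by
  rw [LinearMap.lTensor_comp_apply, hc]
  generalize Ψ c = z
  induction z with
  | zero => simp
  | tmul b c =>
    simp only [contractRight, LinearMap.comp_apply, LinearMap.lTensor_tmul, LinearMap.rTensor_tmul,
      LinearEquiv.coe_coe, TensorProduct.rid_tmul, map_smul]
    generalize Coalgebra.comul (R := ℂ) b = w
    induction w with
    | zero => simp
    | tmul b b' => simp
    | add w w' hw hw' => simp only [TensorProduct.add_tmul, map_add, smul_add, *]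
  | add z z' hz hz' => simp only [map_add, hz, hz']

theorem lTensor_mem_tensorSubmodule {γ : C →ₗ[ℂ] B} (hγ : ∀ c ∈ degreeLT ℂ x n, γ c = 0)
    {z : B ⊗[ℂ] C} (hz : z ∈ lowerTerms inc x n) :
    γ.lTensor B z ∈ tensorSubmodule (incRange inc) ⊤ := by
  suffices lowerTerms inc x n ≤ (tensorSubmodule (incRange inc) ⊤).comap (γ.lTensor B) from this hz
  refine sup_le (Submodule.map₂_le.mpr fun b hb c _ => ?_)
    (Submodule.map₂_le.mpr fun b _ c hc => ?_)
  · exact tmul_mem_tensorSubmodule hb trivial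
  · simp [hγ c hc]

theorem lTensor_tmul_one_mul (γ : C →ₗ[ℂ] B) (b : B) (z : B ⊗[ℂ] C) :
    γ.lTensor B (b ⊗ₜ[ℂ] 1 * z) = b ⊗ₜ[ℂ] 1 * γ.lTensor B z := by
  induction z with
  | zero => simp
  | tmul b' c => simp
  | add z z' hz hz' => simp only [mul_add, map_add, hz, hz']

end Contraction

section Derivable

variable {I A B C : Type*} [Fintype I] [Ring A] [HopfAlgebra ℂ A] [Ring B] [Bialgebra ℂ B]
  [Ring C] [Algebra ℂ C] {Λ : Matrix I I A} {inc : A →ₐc[ℂ] B} {p : I → B} {x : I → C}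

theorem counit_eq_zero_of_sum_mem (hinc : Function.Injective inc)
    (hp : LinearIndependent ℂ ((incRange inc).mkQ ∘ p)) {a : I → A}
    (ha : ∑ s, p s ⊗ₜ[ℂ] 1 * Coalgebra.comul (R := ℂ) (inc (a s)) ∈
      tensorSubmodule (incRange inc) ⊤) (s : I) : Coalgebra.counit (R := ℂ) (a s) = 0 := by
  obtain ⟨θ, hθmul, hθmem, hθcomul⟩ := exists_contract_antipode hinc
  have hpA : ∑ s, p s * algebraMap ℂ B (Coalgebra.counit (R := ℂ) (a s)) ∈ incRange inc := by
    simpa only [map_sum, hθmul, hθcomul] using hθmem _ ha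
  refine Fintype.linearIndependent_iff.mp hp (fun s => Coalgebra.counit (R := ℂ) (a s)) ?_ s
  rw [← (incRange inc).ker_mkQ, LinearMap.mem_ker, map_sum] at hpA
  simpa [-Submodule.mkQ_apply, ← Algebra.commutes, ← Algebra.smul_def] using hpA

variable {Ψ : C →ₐ[ℂ] B ⊗[ℂ] C}

theorem mem_degreeLT_of_sum_mem_lowerTerms (hinc : Function.Injective inc)
    (hp : LinearIndependent ℂ ((incRange inc).mkQ ∘ p)) (hΨ : Ψ ∘ x = transform Λ inc p x)
    (hcounit : ∀ c, contractLeft Coalgebra.counit (Ψ c) = c)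
    (hcoassoc : ∀ c, Ψ.toLinearMap.lTensor B (Ψ c) =
      TensorProduct.assoc ℂ B B C (Coalgebra.comul.rTensor C (Ψ c)))
    {n : ℕ} {d : I → C} (hd : ∀ s, d s ∈ degreeLT ℂ x (n + 1))
    (hsum : ∑ s, p s ⊗ₜ[ℂ] 1 * Ψ (d s) ∈ lowerTerms inc x n) (s : I) :
    d s ∈ degreeLT ℂ x n := by
  -- Contracting the second factor of `Ψ (d s)` with a functional `g` that vanishes in degree less
  -- than `n` gives an element of `A`, whose counit is `g (d s)`.
  refine (Subspace.forall_mem_dualAnnihilator_apply_eq_zero_iff _ _).mp fun g hg => ?_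
  replace hg := (Submodule.mem_dualAnnihilator _).mp hg
  set γ := contractRight g ∘ₗ Ψ.toLinearMap
  have hγ : ∀ c ∈ degreeLT ℂ x n, γ c = 0 := fun c hc => (Submodule.mem_bot ℂ).mp <|
    contractRight_mem hg (Submodule.mem_sup_right (map_mem_tensorSubmodule_degreeLT hΨ hc))
  have hΨd : ∀ s, Ψ (d s) ∈ lowerTerms inc x n := fun s =>
    map_mem_lowerTerms (n := n + 1) hΨ (hd s)
  have hγA : ∀ s, γ (d s) ∈ incRange inc := fun s => contractRight_mem hg (hΨd s)
  choose a ha using hγA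
  change ∀ s, inc (a s) = γ (d s) at ha
  have hcomul : ∑ s, p s ⊗ₜ[ℂ] 1 * Coalgebra.comul (R := ℂ) (inc (a s)) ∈
      tensorSubmodule (incRange inc) ⊤ := by
    convert lTensor_mem_tensorSubmodule hγ hsum using 1
    rw [map_sum]
    refine Finset.sum_congr rfl fun s _ => ?_
    rw [lTensor_tmul_one_mul, ha]
    exact congrArg _ (comul_contractRight (hcoassoc (d s)) g)
  have hε := counit_eq_zero_of_sum_mem hinc hp hcomul s
  calc g (d s) = Coalgebra.counit (R := ℂ) (γ (d s)) := by
        rw [LinearMap.comp_apply, counit_contractRight]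
        exact congrArg g (hcounit (d s)).symm
    _ = 0 := by rw [← ha, CoalgHomClass.counit_comp_apply, hε]

/-- The elements `c`, to be thought of as having degree at most `n`, which admit derivatives `d_s`
of degree less than `n` such that `∑ p_s Ψ(d_s)` is the leading part of `Ψ(c)` modulo `A ⊗ C`, and
for which Euler's formula `∑ x_s d_s = n c` holds up to terms of degree less than `n`. -/
def derivable (inc : A →ₐc[ℂ] B) (p : I → B) (x : I → C) (Ψ : C →ₐ[ℂ] B ⊗[ℂ] C) (n : ℕ) :
    Submodule ℂ C where
  carrier := {c | ∃ d : I → C, (∀ s, d s ∈ degreeLT ℂ x n) ∧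
    Ψ c - ∑ s, p s ⊗ₜ[ℂ] 1 * Ψ (d s) ∈ lowerTerms inc x (n - 1) ∧
    ∑ s, x s * d s - (n : ℂ) • c ∈ degreeLT ℂ x n}
  zero_mem' := ⟨0, by simp⟩
  add_mem' := by
    rintro c c' ⟨d, hd, hΨd, hxd⟩ ⟨d', hd', hΨd', hxd'⟩
    refine ⟨d + d', fun s => add_mem (hd s) (hd' s), ?_, ?_⟩
    · simpa [mul_add, Finset.sum_add_distrib, add_sub_add_comm] using add_mem hΨd hΨd'
    · simpa [mul_add, Finset.sum_add_distrib, add_sub_add_comm] using add_mem hxd hxd'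
  smul_mem' := by
    rintro r c ⟨d, hd, hΨd, hxd⟩
    refine ⟨r • d, fun s => Submodule.smul_mem _ r (hd s), ?_, ?_⟩
    · simpa [smul_sub, Finset.smul_sum] using Submodule.smul_mem _ r hΨd
    · simpa [smul_sub, Finset.smul_sum, smul_comm r] using Submodule.smul_mem _ r hxd

variable [DecidableEq I] {R : Matrix (I × I) (I × I) ℂ} {Z : Matrix (I × I) I ℂ} {T : I × I → ℂ}

theorem degreeLT_le_derivable (h : SatisfiesRelations Λ inc p R Z T)
    (hΨ : Ψ ∘ x = transform Λ inc p x)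
    (hx : ∀ kl, matSmul (R - 1) (outer x x) kl ∈ degreeLT ℂ x 2) (n : ℕ) :
    degreeLT ℂ x (n + 1) ≤ derivable inc p x Ψ n := by
  refine degreeLT_le (N := fun n => derivable inc p x Ψ (n - 1)) ⟨0, ?_⟩ (fun n c hc _ => ?_) ?_ _
  · have h1 := map_mem_lowerTerms (inc := inc) hΨ
      ((degreeLT_one (k := ℂ) x).ge (Submodule.mem_span_singleton_self 1))
    simpa using h1
  · refine ⟨0, fun _ => zero_mem _, ?_, ?_⟩
    · simpa using map_mem_lowerTerms (inc := inc) hΨ hc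
    · simpa [← neg_smul] using Submodule.smul_mem _ _ hc
  · rintro n i c hc ⟨d, hd, hΨd, hxd⟩
    exact ⟨leibniz R x i c d, leibniz_mem hc hd i, map_mul_sub_sum_leibniz_mem h hΨ hd hΨd i,
      sum_mul_leibniz_sub_mem hx hd hxd i⟩

theorem mem_span_one_of_map_mem (h : SatisfiesRelations Λ inc p R Z T)
    (hinc : Function.Injective inc) (hp : LinearIndependent ℂ ((incRange inc).mkQ ∘ p))
    (hΨ : Ψ ∘ x = transform Λ inc p x)
    (hcounit : ∀ c, contractLeft Coalgebra.counit (Ψ c) = c)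
    (hcoassoc : ∀ c, Ψ.toLinearMap.lTensor B (Ψ c) =
      TensorProduct.assoc ℂ B B C (Coalgebra.comul.rTensor C (Ψ c)))
    (hx : Algebra.adjoin ℂ (Set.range x) = ⊤) (hrel : relator R Z T x = 0)
    {c : C} (hc : Ψ c ∈ tensorSubmodule (incRange inc) ⊤) : c ∈ Submodule.span ℂ {1} := by
  obtain ⟨n, hn⟩ := exists_mem_degreeLT hx c
  induction n with
  | zero => exact degreeLT_one (k := ℂ) x ▸ hn
  | succ n ih =>
    have hR : ∀ kl, matSmul (R - 1) (outer x x) kl ∈ degreeLT ℂ x 2 :=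
      (degreeLT_two (k := ℂ) x).symm ▸ matSmul_outer_mem_span hrel
    obtain ⟨d, hd, hΨd, hxd⟩ := degreeLT_le_derivable h hΨ hR (n + 1) hn
    have hsum := sub_mem (Submodule.mem_sup_left hc) hΨd
    rw [sub_sub_cancel] at hsum
    have hdn := mem_degreeLT_of_sum_mem_lowerTerms hinc hp hΨ hcounit hcoassoc hd hsum
    have hmul : ((n + 1 : ℕ) : ℂ) • c ∈ degreeLT ℂ x (n + 1) := by
      rw [← sub_sub_cancel (∑ s, x s * d s) (((n + 1 : ℕ) : ℂ) • c)]
      exact sub_mem (Submodule.sum_mem _ fun s _ =>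
        mul_mem_degreeLT (mem_degreeLT_two x s) (hdn s)) hxd
    exact ih ((Submodule.smul_mem_iff _ (Nat.cast_ne_zero.mpr n.succ_ne_zero)).mp hmul)

end Derivable

section RelatorTransform

variable {I A B D : Type*} [Fintype I] [DecidableEq I] [Ring A] [HopfAlgebra ℂ A]
  [Ring B] [Bialgebra ℂ B] [Ring D] [Algebra ℂ D] {Λ : Matrix I I A} {inc : A →ₐc[ℂ] B} {p : I → B}
  {R : Matrix (I × I) (I × I) ℂ} {Z : Matrix (I × I) I ℂ} {T : I × I → ℂ}

theorem map_tensorMulVec_algebraMap {m n : Type*} [Fintype n] (v : Matrix m n A) (t : n → ℂ) :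
    (v.map inc) ⊗ᵥ[ℂ] (algebraMap ℂ D ∘ t) =
      fun i => inc (v.mulVec (algebraMap ℂ A ∘ t) i) ⊗ₜ[ℂ] (1 : D) := by
  ext i
  simp [tensorMulVec_apply, Matrix.mulVec, dotProduct, TensorProduct.sum_tmul,
    Algebra.algebraMap_eq_smul_one, TensorProduct.smul_tmul']

namespace SatisfiesRelations

variable (h : SatisfiesRelations Λ inc p R Z T)
include h

theorem outer_tensor_one_tensorMulVec (y : I → D) :
    outer (fun i => p i ⊗ₜ[ℂ] (1 : D)) ((Λ.map inc) ⊗ᵥ[ℂ] y) =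
      R •ᵥ outer ((Λ.map inc) ⊗ᵥ[ℂ] y) (fun i => p i ⊗ₜ[ℂ] (1 : D)) +
        (Z •ᵥ ((Λ.map inc) ⊗ᵥ[ℂ] y) - ((Λ ⊗ₖ Λ).map inc) ⊗ᵥ[ℂ] (Z •ᵥ y)) := by
  rw [InhomQG.outer_tensor_one_tensorMulVec, h.commutation, add_tensorMulVec, map_mul_tensorMulVec,
    ← InhomQG.outer_tensorMulVec_tensor_one, map_morDefect_tensorMulVec]

theorem relator_tensor_one (hR : IsMor (Λ ⊗ₖ Λ) (Λ ⊗ₖ Λ) R) :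
    relator R Z T (fun i => p i ⊗ₜ[ℂ] (1 : D)) =
      ((Λ ⊗ₖ Λ).map inc) ⊗ᵥ[ℂ] ((R - 1) •ᵥ (algebraMap ℂ D ∘ T)) := by
  rw [matSmul_algebraMap_comp, map_tensorMulVec_algebraMap]
  have hinc := map_comp_relator (Algebra.TensorProduct.includeLeft : B →ₐ[ℂ] B ⊗[ℂ] D) R Z T p
  rw [h.quadratic_of_isMor hR] at hinc
  exact hinc.symm

theorem relator_transform (hR : IsMor (Λ ⊗ₖ Λ) (Λ ⊗ₖ Λ) R) (y : I → D) :
    relator R Z T (transform Λ inc p y) = ((Λ ⊗ₖ Λ).map inc) ⊗ᵥ[ℂ] relator R Z T y := by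
  set L := (Λ.map inc) ⊗ᵥ[ℂ] y
  set P : I → B ⊗[ℂ] D := fun i => p i ⊗ₜ[ℂ] 1
  have hsum : outer (L + P) (L + P) - Z •ᵥ (L + P) + algebraMap ℂ _ ∘ T =
      ((Λ ⊗ₖ Λ).map inc) ⊗ᵥ[ℂ] (outer y y - Z •ᵥ y) + (R + 1) •ᵥ outer L P +
        (outer P P - Z •ᵥ P + algebraMap ℂ _ ∘ T) := by
    rw [add_outer, outer_add, outer_add, h.outer_tensor_one_tensorMulVec y, outer_tensorMulVec,
      kroneckerMap_map_inc, add_matSmul, one_matSmul, matSmul_add, tensorMulVec_sub]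
    abel
  calc relator R Z T (L + P)
      = ((Λ ⊗ₖ Λ).map inc) ⊗ᵥ[ℂ] ((R - 1) •ᵥ (outer y y - Z •ᵥ y)) + relator R Z T P := by
        rw [relator, hsum, matSmul_add, matSmul_add, ← mul_matSmul, h.sub_one_mul_add_one,
          hR.sub_one.matSmul_tensorMulVec, zero_matSmul, add_zero, relator]
    _ = ((Λ ⊗ₖ Λ).map inc) ⊗ᵥ[ℂ] relator R Z T y := by
        rw [h.relator_tensor_one hR, ← tensorMulVec_add, ← matSmul_add, relator]

end SatisfiesRelations

end RelatorTransform

section Universal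

theorem exists_conj_ringHom {I k E : Type*} [CommRing k] [StarRing k] [Ring E] [Algebra k E]
    (y : I → E) : ∃ σ : FreeAlgebra k I →+* E,
      (∀ (c : k) a, σ (c • a) = star c • σ a) ∧ ∀ i, σ (FreeAlgebra.ι k i) = y i := by
  let conjAlgebra : Algebra k E := Algebra.compHom E (starRingEnd k)
  let σ := @FreeAlgebra.lift k I _ E _ conjAlgebra y
  exact ⟨σ.toRingHom, σ.toLinearMap.map_smul, fun i =>
    @FreeAlgebra.lift_ι_apply k I _ E _ conjAlgebra y i⟩

variable {I : Type*} [Fintype I] [DecidableEq I] {R : Matrix (I × I) (I × I) ℂ}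
  {Z : Matrix (I × I) I ℂ} {T : I × I → ℂ}

theorem minkowskiRelator_eq : minkowskiRelator R Z T = relator R Z T (FreeAlgebra.ι ℂ) := rfl

namespace MinkowskiAlgebra

theorem relator_x : relator R Z T (x R Z T) = 0 := by
  ext kl
  have h := RingQuot.mkAlgHom_rel ℂ (s := fun a b : FreeAlgebra ℂ I =>
    (∃ kl, a = minkowskiRelator R Z T kl) ∧ b = 0) ⟨⟨kl, rfl⟩, rfl⟩
  rw [map_zero, minkowskiRelator_eq, map_relator] at h
  exact h

/-- The algebra homomorphism given by elements that satisfy the relations. -/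
noncomputable def lift {D : Type*} [Ring D] [Algebra ℂ D] (y : I → D) (hy : relator R Z T y = 0) :
    MinkowskiAlgebra R Z T →ₐ[ℂ] D :=
  RingQuot.liftAlgHom ℂ ⟨FreeAlgebra.lift ℂ y, by
    rintro _ _ ⟨⟨kl, rfl⟩, rfl⟩
    have hι : FreeAlgebra.lift ℂ y ∘ FreeAlgebra.ι ℂ = y := FreeAlgebra.ι_comp_lift y
    rw [minkowskiRelator_eq, map_relator, hι, hy, map_zero, Pi.zero_apply]⟩

theorem lift_x {D : Type*} [Ring D] [Algebra ℂ D] (y : I → D) (hy : relator R Z T y = 0) (i : I) :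
    lift y hy (x R Z T i) = y i := by
  simp [lift, x]

theorem adjoin_range_x : Algebra.adjoin ℂ (Set.range (x R Z T)) = ⊤ := by
  have h : Set.range (x R Z T) = RingQuot.mkAlgHom ℂ _ '' Set.range (FreeAlgebra.ι ℂ) :=
    Set.range_comp _ _
  rw [h, ← AlgHom.map_adjoin, FreeAlgebra.adjoin_range_ι, Algebra.map_top, AlgHom.range_eq_top]
  exact RingQuot.mkAlgHom_surjective ℂ _

instance small : Small.{w} (MinkowskiAlgebra R Z T) := by
  let e := (Fintype.equivFin I).symm
  refine small_of_surjective (f := FreeAlgebra.lift ℂ (x R Z T ∘ e)) ?_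
  have he : FreeAlgebra.lift ℂ (x R Z T ∘ e) ∘ FreeAlgebra.ι ℂ = x R Z T ∘ e :=
    FreeAlgebra.ι_comp_lift _
  rw [← AlgHom.range_eq_top, ← Algebra.map_top, ← FreeAlgebra.adjoin_range_ι, AlgHom.map_adjoin,
    ← Set.range_comp, he, e.surjective.range_comp, adjoin_range_x]

theorem exists_conj_antihom (h : IsReal R Z T) :
    ∃ σ : MinkowskiAlgebra R Z T →+* (MinkowskiAlgebra R Z T)ᵐᵒᵖ,
      (∀ (c : ℂ) a, σ (c • a) = star c • σ a) ∧
      ∀ i, σ (x R Z T i) = MulOpposite.op (x R Z T i) := by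
  obtain ⟨φ, hφ, hφx⟩ := exists_conj_ringHom (k := ℂ) fun i => MulOpposite.op (x R Z T i)
  have hrel : ∀ kl, φ (minkowskiRelator R Z T kl) = 0 := fun kl => by
    have hkl := h.antihom_relator φ hφ (FreeAlgebra.ι ℂ) kl.swap
    simp only [hφx, MulOpposite.unop_op, relator_x, Pi.zero_apply] at hkl
    exact MulOpposite.unop_injective hkl
  have hφrel : ∀ ⦃a b⦄, (∃ kl, a = minkowskiRelator R Z T kl) ∧ b = 0 → φ a = φ b := by
    rintro _ _ ⟨⟨kl, rfl⟩, rfl⟩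
    rw [hrel, map_zero]
  have hmk : ∀ a, RingQuot.lift ⟨φ, hφrel⟩ (RingQuot.mkAlgHom ℂ _ a) = φ a := fun a => by
    rw [← RingQuot.lift_mkRingHom_apply φ hφrel, ← RingQuot.mkAlgHom_coe ℂ]
    rfl
  refine ⟨RingQuot.lift ⟨φ, hφrel⟩, fun c a => ?_, fun i => (hmk _).trans (hφx i)⟩
  obtain ⟨a, rfl⟩ := RingQuot.mkAlgHom_surjective ℂ _ a
  rw [← map_smul, hmk, hmk, hφ]

theorem exists_starRing (h : IsReal R Z T) :
    ∃ (_ : StarRing (MinkowskiAlgebra R Z T)) (_ : StarModule ℂ (MinkowskiAlgebra R Z T)),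
      ∀ i, star (x R Z T i) = x R Z T i := by
  obtain ⟨σ, hσ, hσx⟩ := exists_conj_antihom h
  have hinvol : ∀ a, (σ (σ a).unop).unop = a := fun a => by
    have ha : a ∈ Algebra.adjoin ℂ (Set.range (x R Z T)) := by
      simp [adjoin_range_x]
    induction ha using Algebra.adjoin_induction with
    | mem a ha =>
      obtain ⟨i, rfl⟩ := ha
      simp [hσx]
    | algebraMap c => simp [Algebra.algebraMap_eq_smul_one, hσ]
    | add a b _ _ ha hb => simp [ha, hb]
    | mul a b _ _ ha hb => simp [ha, hb]
  let _ : StarRing (MinkowskiAlgebra R Z T) :=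
    { star := fun a => (σ a).unop
      star_involutive := hinvol
      star_mul := fun a b => by simp
      star_add := fun a b => by simp }
  exact ⟨inferInstance, ⟨fun c a => congrArg MulOpposite.unop (hσ c a)⟩,
    fun i => congrArg MulOpposite.unop (hσx i)⟩

end MinkowskiAlgebra

end Universal

section Coactions

variable {I A B C D : Type*} [Fintype I] [Ring A] [HopfAlgebra ℂ A] [Ring B] [Bialgebra ℂ B]
  [Ring C] [Algebra ℂ C] [Ring D] [Algebra ℂ D] {Λ : Matrix I I A} {inc : A →ₐc[ℂ] B} {p : I → B}
  {x : I → C} {Ψ : C →ₐ[ℂ] B ⊗[ℂ] C}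

theorem lTensor_comp_transform (g : C →ₐ[ℂ] D) (y : I → C) :
    g.toLinearMap.lTensor B ∘ transform Λ inc p y = transform Λ inc p (g ∘ y) := by
  ext i
  simp [transform, tensorMulVec_apply]

theorem lTensor_coaction (hx : Algebra.adjoin ℂ (Set.range x) = ⊤)
    (hΨ : Ψ ∘ x = transform Λ inc p x) {Φ : D →ₐ[ℂ] B ⊗[ℂ] D} (g : C →ₐ[ℂ] D)
    (hΦ : Φ ∘ (g ∘ x) = transform Λ inc p (g ∘ x)) (c : C) :
    g.toLinearMap.lTensor B (Ψ c) = Φ (g c) := by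
  have h : (Algebra.TensorProduct.map (AlgHom.id ℂ B) g).comp Ψ = Φ.comp g := by
    refine AlgHom.ext_of_adjoin_eq_top hx ?_
    rintro _ ⟨i, rfl⟩
    refine Eq.trans ?_ (congrFun (hΦ.trans (lTensor_comp_transform g x).symm) i).symm
    exact congrArg (g.toLinearMap.lTensor B) (congrFun hΨ i)
  exact AlgHom.congr_fun h c

theorem tensor_map_subtype_mem (W : Submodule ℂ C) (t : A ⊗[ℂ] W) :
    TensorProduct.map (inc : A →ₐ[ℂ] B).toLinearMap W.subtype t ∈
      tensorSubmodule (incRange inc) ⊤ := by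
  induction t with
  | zero => simp
  | add s t hs ht =>
    rw [map_add]
    exact add_mem hs ht
  | tmul a c => exact tmul_mem_tensorSubmodule (inc_mem_incRange inc a) trivial

variable [DecidableEq I]

theorem counit_coaction (hG : IsInhomogeneous Λ inc p) (hΛ : IsRep Λ)
    (hx : Algebra.adjoin ℂ (Set.range x) = ⊤) (hΨ : Ψ ∘ x = transform Λ inc p x) (c : C) :
    contractLeft Coalgebra.counit (Ψ c) = c := by
  have h : ((Algebra.TensorProduct.lid ℂ C).toAlgHom.comp (Algebra.TensorProduct.map
      (Bialgebra.counitAlgHom ℂ B) (AlgHom.id ℂ C))).comp Ψ = AlgHom.id ℂ C := by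
    refine AlgHom.ext_of_adjoin_eq_top hx ?_
    rintro _ ⟨i, rfl⟩
    have hp : Coalgebra.counit (R := ℂ) (p i) = 0 := by
      simpa using hG.isRep.counit (Sum.inl i) (Sum.inr ())
    have hi : Ψ (x i) = transform Λ inc p x i := congrFun hΨ i
    simp [hi, transform, tensorMulVec_apply, hp, hΛ.counit]
  exact AlgHom.congr_fun h c

theorem coassoc_coaction (hG : IsInhomogeneous Λ inc p) (hΛ : IsRep Λ)
    (hx : Algebra.adjoin ℂ (Set.range x) = ⊤) (hΨ : Ψ ∘ x = transform Λ inc p x) (c : C) :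
    Ψ.toLinearMap.lTensor B (Ψ c) =
      TensorProduct.assoc ℂ B B C (Coalgebra.comul.rTensor C (Ψ c)) := by
  have h : (Algebra.TensorProduct.map (AlgHom.id ℂ B) Ψ).comp Ψ =
      ((Algebra.TensorProduct.assoc ℂ ℂ ℂ B B C).toAlgHom.comp (Algebra.TensorProduct.map
      (Bialgebra.comulAlgHom ℂ B) (AlgHom.id ℂ C))).comp Ψ := by
    refine AlgHom.ext_of_adjoin_eq_top hx ?_
    rintro _ ⟨i, rfl⟩
    have hi (j : I) : Ψ (x j) = transform Λ inc p x j := congrFun hΨ j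
    simp only [AlgHom.coe_comp, Function.comp_apply, hi, transform, Pi.add_apply,
      tensorMulVec_apply, Matrix.map_apply, map_add, map_sum, Algebra.TensorProduct.map_tmul,
      AlgHom.coe_id, id_eq, TensorProduct.tmul_add, TensorProduct.tmul_sum, Finset.sum_add_distrib,
      map_one, Algebra.TensorProduct.one_def, AlgEquiv.coe_toAlgHom, Bialgebra.comulAlgHom_apply,
      hΛ.comul_inc, TensorProduct.sum_tmul, hG.comul_p, TensorProduct.add_tmul,
      Algebra.TensorProduct.assoc_tmul]
    rw [add_assoc, Finset.sum_comm]
  exact AlgHom.congr_fun h c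

end Coactions

section Star

theorem map_star_of_adjoin_eq_top {ι C D : Type*} [Ring C] [Algebra ℂ C] [StarRing C]
    [StarModule ℂ C] [Ring D] [Algebra ℂ D] [StarRing D] [StarModule ℂ D] {x : ι → C}
    (hgen : Algebra.adjoin ℂ (Set.range x) = ⊤) (g : C →ₐ[ℂ] D)
    (hx : ∀ i, star (x i) = x i) (hg : ∀ i, star (g (x i)) = g (x i)) (c : C) :
    g (star c) = star (g c) := by
  have hc : c ∈ Algebra.adjoin ℂ (Set.range x) := hgen ▸ Algebra.mem_top
  induction hc using Algebra.adjoin_induction with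
  | mem c hc =>
    obtain ⟨i, rfl⟩ := hc
    rw [hx, hg]
  | algebraMap r =>
    rw [← algebraMap_star_comm, AlgHom.commutes, AlgHom.commutes, algebraMap_star_comm]
  | add a b _ _ ha hb => rw [star_add, map_add, map_add, star_add, ha, hb]
  | mul a b _ _ ha hb => rw [star_mul, map_mul, map_mul, star_mul, ha, hb]

theorem star_transform {I A B C : Type*} [Fintype I] [Ring A] [HopfAlgebra ℂ A] [StarRing A]
    [StarModule ℂ A] [Ring B] [Bialgebra ℂ B] [StarRing B] [StarModule ℂ B] [Ring C] [Algebra ℂ C]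
    [StarRing C] [StarModule ℂ C] {Λ : Matrix I I A} {inc : A →ₐc[ℂ] B} {p : I → B}
    (hs : IsStarCompatible inc p) (hsΛ : ∀ i j, star (Λ i j) = Λ i j) {y : I → C}
    (hy : ∀ i, star (y i) = y i) (i : I) :
    star (transform Λ inc p y i) = transform Λ inc p y i := by
  simp [transform, tensorMulVec_apply, ← hs.inc_star, hsΛ, hs.star_p, hy]

theorem adjoin_range_comp_starAlgEquiv {ι C D : Type*} [Ring C] [Algebra ℂ C] [Star C] [Ring D]
    [Algebra ℂ D] [Star D] {x : ι → C} (hx : Algebra.adjoin ℂ (Set.range x) = ⊤)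
    (e : C ≃⋆ₐ[ℂ] D) : Algebra.adjoin ℂ (Set.range (e ∘ x)) = ⊤ := by
  have h := AlgHom.map_adjoin (e : C →⋆ₐ[ℂ] D).toAlgHom (Set.range x)
  rw [hx, Algebra.map_top, (AlgHom.range_eq_top _).mpr e.surjective, ← Set.range_comp] at h
  exact h.symm

theorem exists_starAlgEquiv_of_small (D : Type*) [Ring D] [Algebra ℂ D] [StarRing D]
    [StarModule ℂ D] [Small.{w} D] :
    ∃ (C : Type w) (_ : Ring C) (_ : Algebra ℂ C) (_ : StarRing C) (_ : StarModule ℂ C),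
      Nonempty (D ≃⋆ₐ[ℂ] C) := by
  let e : Shrink.{w} D ≃ₐ[ℂ] D := Shrink.algEquiv ℂ D
  let _ : StarRing (Shrink.{w} D) :=
    { star := fun a => e.symm (star (e a))
      star_involutive := fun a => by simp
      star_mul := fun a b => by simp
      star_add := fun a b => by simp }
  have star_def (a : Shrink.{w} D) : star a = e.symm (star (e a)) := rfl
  refine ⟨Shrink.{w} D, inferInstance, inferInstance, inferInstance,
    ⟨fun c a => by simp [star_def]⟩, ⟨StarAlgEquiv.ofBijective
      ({ e.symm.toAlgHom with map_star' := fun a => ?_ } : D →⋆ₐ[ℂ] Shrink.{w} D)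
      e.symm.bijective⟩⟩
  change e.symm (star a) = star (e.symm a)
  rw [star_def, e.apply_symm_apply]

theorem exists_starAlgEquiv_of_adjoin_eq_top {ι C D : Type*} [Ring C] [Algebra ℂ C] [Star C]
    [Ring D] [Algebra ℂ D] [Star D] {x : ι → C} {y : ι → D}
    (hx : Algebra.adjoin ℂ (Set.range x) = ⊤) (hy : Algebra.adjoin ℂ (Set.range y) = ⊤)
    (σ : C →⋆ₐ[ℂ] D) (τ : D →⋆ₐ[ℂ] C) (hσ : ∀ i, σ (x i) = y i) (hτ : ∀ i, τ (y i) = x i) :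
    ∃ e : C ≃⋆ₐ[ℂ] D, ∀ c, e c = σ c := by
  have hτσ : τ.toAlgHom.comp σ.toAlgHom = AlgHom.id ℂ C := AlgHom.ext_of_adjoin_eq_top hx <| by
    rintro _ ⟨i, rfl⟩
    exact (congrArg τ (hσ i)).trans (hτ i)
  have hστ : σ.toAlgHom.comp τ.toAlgHom = AlgHom.id ℂ D := AlgHom.ext_of_adjoin_eq_top hy <| by
    rintro _ ⟨i, rfl⟩
    exact (congrArg σ (hτ i)).trans (hσ i)
  exact ⟨StarAlgEquiv.ofStarAlgHom σ τ (StarAlgHom.ext (AlgHom.congr_fun hτσ))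
    (StarAlgHom.ext (AlgHom.congr_fun hστ)), fun _ => rfl⟩

theorem forall_lTensor_eq_iff {I A B C D : Type*} [Fintype I] [Ring A] [HopfAlgebra ℂ A] [Ring B]
    [Bialgebra ℂ B] [Ring C] [Algebra ℂ C] [Star C] [Ring D] [Algebra ℂ D] [Star D]
    {Λ : Matrix I I A} {inc : A →ₐc[ℂ] B} {p : I → B} {Ψ : C →ₐ[ℂ] B ⊗[ℂ] C}
    {Φ : D →ₐ[ℂ] B ⊗[ℂ] D} {y : I → D} (hy : Algebra.adjoin ℂ (Set.range y) = ⊤)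
    (hΦ : Φ ∘ y = transform Λ inc p y) (e : C ≃⋆ₐ[ℂ] D) :
    (∀ c, (e : C →⋆ₐ[ℂ] D).toAlgHom.toLinearMap.lTensor B (Ψ c) = Φ (e c)) ↔
      Ψ ∘ (e.symm ∘ y) = transform Λ inc p (e.symm ∘ y) := by
  have hey : (e : C →⋆ₐ[ℂ] D).toAlgHom ∘ (e.symm ∘ y) = y :=
    funext fun i => e.apply_symm_apply (y i)
  refine ⟨fun h => funext fun i => ?_, fun hΨ => ?_⟩
  · apply Module.Flat.lTensor_preserves_injective_linearMap (M := B)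
      (e : C →⋆ₐ[ℂ] D).toAlgHom.toLinearMap e.injective
    have hi := congrFun (lTensor_comp_transform (Λ := Λ) (inc := inc) (p := p)
      (e : C →⋆ₐ[ℂ] D).toAlgHom (e.symm ∘ y)) i
    rw [hey, ← hΦ] at hi
    exact (h _).trans ((congrArg Φ (e.apply_symm_apply _)).trans hi.symm)
  · refine lTensor_coaction ?_ hΨ (e : C →⋆ₐ[ℂ] D).toAlgHom (hey.symm ▸ hΦ)
    exact adjoin_range_comp_starAlgEquiv hy e.symm

end Star

section Minkowski

variable {I A B C : Type*} [Fintype I] [Ring A] [HopfAlgebra ℂ A] [Ring B] [Bialgebra ℂ B]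
  [StarRing B] [StarModule ℂ B] [Ring C] [Algebra ℂ C] [StarRing C] [StarModule ℂ C]
  {Λ : Matrix I I A} {inc : A →ₐc[ℂ] B} {p : I → B} {Ψ : C →⋆ₐ[ℂ] B ⊗[ℂ] C} {x : I → C}

theorem IsMinkowskiPre.eq_algebraMap_of_map_eq [Nontrivial C] (hpre : IsMinkowskiPre Λ inc p Ψ x)
    (hinc : Function.Injective inc) {J : Type*} [Fintype J] {v : Matrix J J A} {y : J → C}
    (hy : Ψ ∘ y = tensorMulVec ℂ (v.map inc) y) :
    ∃ t : J → ℂ, y = algebraMap ℂ C ∘ t ∧ v.mulVec (algebraMap ℂ A ∘ t) = algebraMap ℂ A ∘ t := by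
  have hmap : Submodule.span ℂ (Set.range y) ≤ (LinearMap.range (TensorProduct.map
      (inc : A →ₐ[ℂ] B).toLinearMap (Submodule.span ℂ (Set.range y)).subtype)).comap
        Ψ.toAlgHom.toLinearMap := Submodule.span_le.mpr <| by
    rintro _ ⟨j, rfl⟩
    have hj : Ψ (y j) = ((v.map inc) ⊗ᵥ[ℂ] y) j := congrFun hy j
    rw [SetLike.mem_coe, Submodule.mem_comap, AlgHom.toLinearMap_apply, StarAlgHom.coe_toAlgHom, hj]
    exact Submodule.sum_mem _ fun l _ =>
      ⟨v j l ⊗ₜ ⟨y l, Submodule.subset_span ⟨l, rfl⟩⟩, rfl⟩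
  have hscalar (j : J) : ∃ r : ℂ, algebraMap ℂ C r = y j := by
    simpa only [Submodule.mem_span_singleton, Algebra.algebraMap_eq_smul_one] using
      hpre.eq_scalar _ (fun _ hc => hmap hc) (Submodule.subset_span ⟨j, rfl⟩)
  choose t ht using hscalar
  obtain rfl : algebraMap ℂ C ∘ t = y := funext ht
  refine ⟨t, rfl, funext fun j => hinc ?_⟩
  rw [map_tensorMulVec_algebraMap] at hy
  refine Algebra.TensorProduct.includeLeft_injective (S := ℂ) (R := ℂ) (A := B) (B := C)
    (algebraMap ℂ C).injective ((congrFun hy j).symm.trans ?_)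
  exact (AlgHomClass.commutes Ψ (t j)).trans (by
    simp [Algebra.TensorProduct.algebraMap_apply, AlgHomClass.commutes inc])

variable [DecidableEq I] {R : Matrix (I × I) (I × I) ℂ} {Z : Matrix (I × I) I ℂ} {T : I × I → ℂ}

theorem isMinkowskiPre_of_relator_eq_zero (h : SatisfiesRelations Λ inc p R Z T)
    (hG : IsInhomogeneous Λ inc p) (hΛ : IsIrrep Λ) (hx : Algebra.adjoin ℂ (Set.range x) = ⊤)
    (hrel : relator R Z T x = 0) (hstar : ∀ i, star (x i) = x i)
    (hΨ : Ψ ∘ x = transform Λ inc p x) : IsMinkowskiPre Λ inc p Ψ x where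
  generated := hx
  counit := counit_coaction (Ψ := Ψ.toAlgHom) hG hΛ.isRep hx hΨ
  coassoc := coassoc_coaction (Ψ := Ψ.toAlgHom) hG hΛ.isRep hx hΨ
  star_x := hstar
  coaction := congrFun hΨ
  eq_scalar W hW y hy := by
    obtain ⟨t, ht⟩ := hW y hy
    refine mem_span_one_of_map_mem (Ψ := Ψ.toAlgHom) h hG.inc_injective
      (hG.linearIndependent_mkQ hΛ) hΨ (counit_coaction hG hΛ.isRep hx hΨ)
      (coassoc_coaction hG hΛ.isRep hx hΨ) hx hrel ?_
    exact ht ▸ tensor_map_subtype_mem W t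

theorem IsMinkowskiPre.relator_eq_zero (h : SatisfiesRelations Λ inc p R Z T)
    (hG : IsInhomogeneous Λ inc p) (hΛ : IsIrrep Λ)
    (hinv : ∀ t : I × I → ℂ, (Λ ⊗ₖ Λ).mulVec (algebraMap ℂ A ∘ t) = algebraMap ℂ A ∘ t →
      (R + 1).mulVec t = 0 → t = 0)
    (hpre : IsMinkowskiPre Λ inc p Ψ x) : relator R Z T x = 0 := by
  nontriviality C
  have hΨ : Ψ ∘ x = transform Λ inc p x := funext hpre.coaction
  have hcoaction : Ψ ∘ relator R Z T x = ((Λ ⊗ₖ Λ).map inc) ⊗ᵥ[ℂ] relator R Z T x := by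
    rw [← h.relator_transform (h.isMor_R hG hΛ), ← hΨ]
    exact map_comp_relator Ψ.toAlgHom R Z T x
  obtain ⟨t, ht, htΛ⟩ := hpre.eq_algebraMap_of_map_eq hG.inc_injective hcoaction
  have htR : (R + 1).mulVec t = 0 := by
    have hR : (R + 1) •ᵥ relator R Z T x = 0 := by
      rw [relator, ← mul_matSmul, h.add_one_mul_sub_one, zero_matSmul]
    rw [ht, matSmul_algebraMap_comp] at hR
    exact funext fun kl => (algebraMap ℂ C).injective ((congrFun hR kl).trans (map_zero _).symm)
  rw [ht, hinv t htΛ htR]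
  exact funext fun _ => map_zero _

end Minkowski

section Universality

variable {I A B : Type*} [Fintype I] [DecidableEq I] [Ring A] [HopfAlgebra ℂ A]
  [Ring B] [Bialgebra ℂ B] [StarRing B] [StarModule ℂ B] {Λ : Matrix I I A} {inc : A →ₐc[ℂ] B}
  {p : I → B} {R : Matrix (I × I) (I × I) ℂ} {Z : Matrix (I × I) I ℂ} {T : I × I → ℂ}

open InhomQG.MinkowskiAlgebra (x adjoin_range_x relator_x)

theorem MinkowskiAlgebra.relator_comp_x {D : Type*} [Ring D] [Algebra ℂ D] [Star D]
    [Star (MinkowskiAlgebra R Z T)] (e : MinkowskiAlgebra R Z T ≃⋆ₐ[ℂ] D) :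
    relator R Z T (e ∘ x R Z T) = 0 := by
  have h := map_comp_relator (e : MinkowskiAlgebra R Z T →⋆ₐ[ℂ] D).toAlgHom R Z T (x R Z T)
  rw [relator_x] at h
  exact h.symm.trans (funext fun _ => map_zero e)

variable [StarRing (MinkowskiAlgebra R Z T)]

theorem MinkowskiAlgebra.exists_starAlgHom [StarModule ℂ (MinkowskiAlgebra R Z T)]
    {D : Type*} [Ring D] [Algebra ℂ D] [StarRing D] [StarModule ℂ D]
    (hstar : ∀ i, star (x R Z T i) = x R Z T i) {y : I → D}
    (hrel : relator R Z T y = 0) (hy : ∀ i, star (y i) = y i) :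
    ∃ ρ : MinkowskiAlgebra R Z T →⋆ₐ[ℂ] D, ∀ i, ρ (x R Z T i) = y i :=
  ⟨{ lift y hrel with
      map_star' := map_star_of_adjoin_eq_top adjoin_range_x (lift y hrel) hstar fun i => by
        rw [lift_x, hy] }, lift_x y hrel⟩

variable (h : SatisfiesRelations Λ inc p R Z T) (hG : IsInhomogeneous Λ inc p) (hΛ : IsIrrep Λ)
  (hstar : ∀ i, star (x R Z T i) = x R Z T i)
include h hG hΛ hstar

theorem isMinkowskiPre_comp_x {D : Type*} [Ring D] [Algebra ℂ D] [StarRing D] [StarModule ℂ D]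
    (e : MinkowskiAlgebra R Z T ≃⋆ₐ[ℂ] D) {Ψ : D →⋆ₐ[ℂ] B ⊗[ℂ] D}
    (hΨ : Ψ ∘ (e ∘ x R Z T) = transform Λ inc p (e ∘ x R Z T)) :
    IsMinkowskiPre Λ inc p Ψ (e ∘ x R Z T) :=
  isMinkowskiPre_of_relator_eq_zero h hG hΛ (adjoin_range_comp_starAlgEquiv adjoin_range_x e)
    (MinkowskiAlgebra.relator_comp_x e) (fun i => by rw [Function.comp_apply, ← map_star, hstar]) hΨ

variable [StarModule ℂ (MinkowskiAlgebra R Z T)]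

theorem isMinkowski_of_starAlgEquiv {C : Type w} [Ring C] [Algebra ℂ C] [StarRing C]
    [StarModule ℂ C]
    (hinv : ∀ t : I × I → ℂ, (Λ ⊗ₖ Λ).mulVec (algebraMap ℂ A ∘ t) = algebraMap ℂ A ∘ t →
      (R + 1).mulVec t = 0 → t = 0)
    (e : MinkowskiAlgebra R Z T ≃⋆ₐ[ℂ] C) {Ψ : C →⋆ₐ[ℂ] B ⊗[ℂ] C}
    (hΨ : Ψ ∘ (e ∘ x R Z T) = transform Λ inc p (e ∘ x R Z T)) : IsMinkowski Λ inc p Ψ := by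
  refine ⟨_, isMinkowskiPre_comp_x h hG hΛ hstar e hΨ, fun C' _ _ _ _ Ψ' x' hx' => ?_⟩
  obtain ⟨ρ, hρ⟩ := MinkowskiAlgebra.exists_starAlgHom hstar
    (hx'.relator_eq_zero h hG hΛ hinv) hx'.star_x
  let ρe : C →⋆ₐ[ℂ] C' := ρ.comp (e.symm : C →⋆ₐ[ℂ] MinkowskiAlgebra R Z T)
  have hρe : ρe ∘ (e ∘ x R Z T) = x' :=
    funext fun i => (congrArg ρ (e.symm_apply_apply _)).trans (hρ i)
  refine ⟨ρe, congrFun hρe, lTensor_coaction (adjoin_range_comp_starAlgEquiv adjoin_range_x e)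
    (Ψ := Ψ.toAlgHom) hΨ (Φ := Ψ'.toAlgHom) ρe.toAlgHom ?_⟩
  exact hρe ▸ funext hx'.coaction

variable [StarRing A] [StarModule ℂ A] (hs : IsStarCompatible inc p)
  (hsΛ : ∀ i j, star (Λ i j) = Λ i j)
include hs hsΛ

theorem MinkowskiAlgebra.exists_coaction {D : Type*} [Ring D] [Algebra ℂ D] [StarRing D]
    [StarModule ℂ D] (e : MinkowskiAlgebra R Z T ≃⋆ₐ[ℂ] D) :
    ∃ Ψ : D →⋆ₐ[ℂ] B ⊗[ℂ] D, Ψ ∘ (e ∘ x R Z T) = transform Λ inc p (e ∘ x R Z T) := by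
  have hrel : relator R Z T (transform Λ inc p (e ∘ x R Z T)) = 0 := by
    rw [h.relator_transform (h.isMor_R hG hΛ), relator_comp_x e, tensorMulVec_zero]
  have hex (i : I) : star ((e ∘ x R Z T) i) = (e ∘ x R Z T) i := by
    rw [Function.comp_apply, ← map_star, hstar]
  obtain ⟨ψ, hψ⟩ := exists_starAlgHom hstar hrel (star_transform hs hsΛ hex)
  exact ⟨ψ.comp (e.symm : D →⋆ₐ[ℂ] MinkowskiAlgebra R Z T), funext fun i =>
    (congrArg ψ (e.symm_apply_apply _)).trans (hψ i)⟩

variable (hinv : ∀ t : I × I → ℂ,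
  (Λ ⊗ₖ Λ).mulVec (algebraMap ℂ A ∘ t) = algebraMap ℂ A ∘ t → (R + 1).mulVec t = 0 → t = 0)
  {C : Type w} [Ring C] [Algebra ℂ C] [StarRing C] [StarModule ℂ C] {Ψ : C →⋆ₐ[ℂ] B ⊗[ℂ] C}
include hinv

theorem IsMinkowski.exists_starAlgEquiv (hΨ : IsMinkowski Λ inc p Ψ) :
    ∃ e : MinkowskiAlgebra R Z T ≃⋆ₐ[ℂ] C,
      Ψ ∘ (e ∘ x R Z T) = transform Λ inc p (e ∘ x R Z T) := by
  obtain ⟨y, hy, huniv⟩ := hΨ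
  -- Axiom 3 only quantifies over the universe of `C`, so it is applied to a copy of the
  -- universal algebra there.
  obtain ⟨C₁, _, _, _, _, ⟨e₁⟩⟩ := exists_starAlgEquiv_of_small.{w} (MinkowskiAlgebra R Z T)
  obtain ⟨Ψ₁, hΨ₁⟩ := MinkowskiAlgebra.exists_coaction h hG hΛ hstar hs hsΛ e₁
  obtain ⟨ρ, hρ, -⟩ := huniv C₁ Ψ₁ _ (isMinkowskiPre_comp_x h hG hΛ hstar e₁ hΨ₁)
  obtain ⟨σ, hσ⟩ := MinkowskiAlgebra.exists_starAlgHom hstar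
    (hy.relator_eq_zero h hG hΛ hinv) hy.star_x
  obtain ⟨e, he⟩ := exists_starAlgEquiv_of_adjoin_eq_top adjoin_range_x hy.generated σ
    ((e₁.symm : C₁ →⋆ₐ[ℂ] MinkowskiAlgebra R Z T).comp ρ) hσ
    fun i => (congrArg e₁.symm (hρ i)).trans (e₁.symm_apply_apply _)
  have hey : e ∘ x R Z T = y := funext fun i => (he _).trans (hσ i)
  exact ⟨e, hey ▸ funext hy.coaction⟩

theorem isMinkowski_iff_exists_starAlgEquiv
    {Ψ₀ : MinkowskiAlgebra R Z T →⋆ₐ[ℂ] B ⊗[ℂ] MinkowskiAlgebra R Z T}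
    (hΨ₀ : Ψ₀ ∘ x R Z T = transform Λ inc p (x R Z T)) :
    IsMinkowski Λ inc p Ψ ↔ ∃ e : C ≃⋆ₐ[ℂ] MinkowskiAlgebra R Z T,
      ∀ c, (e : C →⋆ₐ[ℂ] MinkowskiAlgebra R Z T).toAlgHom.toLinearMap.lTensor B (Ψ c) =
        Ψ₀ (e c) := by
  have hiff := forall_lTensor_eq_iff (Ψ := Ψ.toAlgHom) (Φ := Ψ₀.toAlgHom) adjoin_range_x hΨ₀
  constructor
  · intro hΨ
    obtain ⟨e, he⟩ := hΨ.exists_starAlgEquiv h hG hΛ hstar hs hsΛ hinv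
    exact ⟨e.symm, (hiff e.symm).mpr he⟩
  · rintro ⟨e, he⟩
    exact isMinkowski_of_starAlgEquiv h hG hΛ hstar hinv e.symm ((hiff e).mp he)

end Universality

section Hypotheses

variable {A : Type*} [Ring A] {n m : Type*} [Fintype n] [Fintype m]

theorem isMor_trivialRep_replicateCol [Bialgebra ℂ A] {v : Matrix n n A} {t : n → ℂ}
    (ht : v.mulVec (algebraMap ℂ A ∘ t) = algebraMap ℂ A ∘ t) :
    IsMor (trivialRep A) v (Matrix.replicateCol Unit t) := by
  have hmap : (Matrix.replicateCol Unit t).map (algebraMap ℂ A) =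
      Matrix.replicateCol Unit (algebraMap ℂ A ∘ t) := rfl
  rw [IsMor, trivialRep, Matrix.mul_one, hmap, ← Matrix.replicateCol_mulVec, ht]

variable [DecidableEq n] [DecidableEq m]

theorem IsIrrep.submatrix_equiv [Bialgebra ℂ A] {v : Matrix n n A} (hv : IsIrrep v) (e : m ≃ n) :
    IsIrrep (v.submatrix e e) where
  isRep :=
    { comul i j := by
        simp only [Matrix.submatrix_apply, hv.isRep.comul]
        exact (e.sum_comp fun k => v (e i) k ⊗ₜ[ℂ] v k (e j)).symm
      counit i j := by simp [hv.isRep.counit] }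
  nonempty := e.nonempty_congr.mpr hv.nonempty
  eq_bot_or_eq_top W hW := by
    let E : (n → ℂ) ≃ₗ[ℂ] m → ℂ := LinearEquiv.funCongrLeft ℂ ℂ e
    have hinv : IsInvariant v (W.comap E.toLinearMap) := fun φ y hy => by
      have hφ := hW φ _ hy
      rwa [← Matrix.submatrix_map, Matrix.submatrix_mulVec_equiv,
        show E.toLinearMap y ∘ e.symm = y from E.symm_apply_apply y] at hφ
    have hmap : (W.comap E.toLinearMap).map E.toLinearMap = W :=
      Submodule.map_comap_eq_of_surjective E.surjective W
    rcases hv.eq_bot_or_eq_top _ hinv with h | h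
    · exact Or.inl (by rw [← hmap, h, Submodule.map_bot])
    · exact Or.inr (by rw [← hmap, h, Submodule.map_top, E.range])

theorem isIrrep_one [Bialgebra ℂ A] [Unique n] : IsIrrep (1 : Matrix n n A) where
  isRep :=
    { comul i j := by
        obtain rfl := Subsingleton.elim i j
        simp [← Unique.eq_default i, Algebra.TensorProduct.one_def]
      counit i j := by
        obtain rfl := Subsingleton.elim i j
        simp }
  nonempty := inferInstance
  eq_bot_or_eq_top W _ := by
    have : IsSimpleModule ℂ (n → ℂ) :=
      isSimpleModule_iff_finrank_eq_one.mpr (by simp)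
    exact eq_bot_or_eq_top W

theorem IsHomogeneousPart.eq_zero_of_isMor [HopfAlgebra ℂ A] [StarRing A] [StarModule ℂ A]
    {Λ : Matrix n n A} (hH : IsHomogeneousPart Λ) {M : Matrix (n × n) n ℂ}
    (hM : IsMor Λ (Λ ⊗ₖ Λ) M) : M = 0 := by
  let e := (Fintype.equivFin n).symm
  let e₁ : Fin (Fintype.card n) × Fin 1 ≃ n := (Equiv.prodUnique _ _).trans e
  let e₂ : n × Fin (Fintype.card n) × Fin 1 ≃ n × n := (Equiv.refl n).prodCongr e₁
  have hΛ : Λ.submatrix e e ⊗ₖ (1 : Matrix (Fin 1) (Fin 1) A) = Λ.submatrix e₁ e₁ := by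
    ext ⟨i, a⟩ ⟨j, b⟩
    simp [e₁, Subsingleton.elim a b]
  have hzero : M.submatrix e₂ e₁ = 0 := by
    refine hH.mor_eq_zero _ _ _ _ (hH.irreducible.submatrix_equiv e) isIrrep_one _ ?_
    have hΛ₂ : Λ ⊗ₖ Λ.submatrix e₁ e₁ = (Λ ⊗ₖ Λ).submatrix e₂ e₂ := rfl
    rw [hΛ, hΛ₂, IsMor, ← Matrix.submatrix_map, Matrix.submatrix_mul_equiv,
      Matrix.submatrix_mul_equiv, hM]
  simpa using congrArg (Matrix.submatrix · e₂.symm e₁.symm) hzero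

end Hypotheses
end InhomQG

open InhomQG

theorem theorem5p6_general {I : Type*} [Fintype I] [DecidableEq I]
    {A : Type*} [Ring A] [HopfAlgebra ℂ A] [StarRing A] [StarModule ℂ A]
    (Λ : Matrix I I A) (hΛ : IsIrrep Λ) (hsΛ : ∀ i j, star (Λ i j) = Λ i j)
    (hmor : ∀ M : Matrix (I × I) I ℂ, IsMor Λ (Λ ⊗ₖ Λ) M → M = 0)
    {B : Type*} [Ring B] [Bialgebra ℂ B] [StarRing B] [StarModule ℂ B]
    (inc : A →ₐc[ℂ] B) (p : I → B)
    (f : I → I → A →ₗ[ℂ] ℂ) (η : I → A →ₗ[ℂ] ℂ) (T : I × I → ℂ)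
    (hG : IsInhomogeneous Λ inc p) (hd : IsDescribedBy Λ inc p f η T)
    (hs : IsStarCompatible inc p)
    (h₂ : ∀ M : Matrix (I × I) Unit ℂ, IsMor (trivialRep A) (Λ ⊗ₖ Λ) M →
      (matR Λ f + 1) * M = 0 → M = 0) :
    ∃ (_ : StarRing (MinkowskiAlgebra (matR Λ f) (matZ Λ η) T))
      (_ : StarModule ℂ (MinkowskiAlgebra (matR Λ f) (matZ Λ η) T))
      (Ψ₀ : MinkowskiAlgebra (matR Λ f) (matZ Λ η) T →⋆ₐ[ℂ]
        B ⊗[ℂ] MinkowskiAlgebra (matR Λ f) (matZ Λ η) T),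
      (∀ i, star (MinkowskiAlgebra.x (matR Λ f) (matZ Λ η) T i) =
        MinkowskiAlgebra.x (matR Λ f) (matZ Λ η) T i) ∧
      (∀ i, Ψ₀ (MinkowskiAlgebra.x (matR Λ f) (matZ Λ η) T i) =
        ∑ j, inc (Λ i j) ⊗ₜ[ℂ] MinkowskiAlgebra.x (matR Λ f) (matZ Λ η) T j
          + p i ⊗ₜ[ℂ] (1 : MinkowskiAlgebra (matR Λ f) (matZ Λ η) T)) ∧
      IsMinkowski Λ inc p Ψ₀ ∧
      ∀ (C : Type w) [Ring C] [Algebra ℂ C] [StarRing C] [StarModule ℂ C]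
        (Ψ : C →⋆ₐ[ℂ] B ⊗[ℂ] C),
        IsMinkowski Λ inc p Ψ ↔
          ∃ e : C ≃⋆ₐ[ℂ] MinkowskiAlgebra (matR Λ f) (matZ Λ η) T,
            ∀ c, LinearMap.lTensor B
              (e : C →⋆ₐ[ℂ] MinkowskiAlgebra (matR Λ f) (matZ Λ η) T).toAlgHom.toLinearMap (Ψ c) =
                Ψ₀ (e c) := by
  have h := hd.satisfiesRelations hΛ.isRep
  have hinv (t : I × I → ℂ) (ht : (Λ ⊗ₖ Λ).mulVec (algebraMap ℂ A ∘ t) = algebraMap ℂ A ∘ t)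
      (hRt : (matR Λ f + 1).mulVec t = 0) : t = 0 := by
    refine Matrix.replicateCol_injective (h₂ _ (isMor_trivialRep_replicateCol ht) ?_)
    rw [← Matrix.replicateCol_mulVec, hRt, Matrix.replicateCol_zero]
  obtain ⟨_, _, hstar⟩ := MinkowskiAlgebra.exists_starRing (h.isReal hs hsΛ hG hΛ hmor hinv)
  obtain ⟨Ψ₀, hΨ₀⟩ := MinkowskiAlgebra.exists_coaction h hG hΛ hstar hs hsΛ (StarAlgEquiv.refl ..)
  exact ⟨_, _, Ψ₀, hstar, congrFun hΨ₀,
    isMinkowski_of_starAlgEquiv h hG hΛ hstar hinv (StarAlgEquiv.refl ..) hΨ₀,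
    fun _ _ _ _ _ _ => isMinkowski_iff_exists_starAlgEquiv h hG hΛ hstar hs hsΛ hinv hΨ₀⟩

theorem theorem5p6 {I : Type*} [Fintype I] [DecidableEq I]
    -- the Hopf `*`-algebra `A = Poly(H)` with the representation `Λ`
    {A : Type*} [Ring A] [HopfAlgebra ℂ A] [StarRing A] [StarModule ℂ A]
    (Λ : Matrix I I A) (hH : IsHomogeneousPart Λ)
    -- the `*`-bialgebra `B = Poly(G)`, described by `p`, `f`, `η`, `T`
    {B : Type*} [Ring B] [Bialgebra ℂ B] [StarRing B] [StarModule ℂ B]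
    (inc : A →ₐc[ℂ] B) (p : I → B)
    (f : I → I → A →ₗ[ℂ] ℂ) (η : I → A →ₗ[ℂ] ℂ) (T : I × I → ℂ)
    (hG : IsInhomogeneous Λ inc p) (hd : IsDescribedBy Λ inc p f η T)
    (hs : IsStarCompatible inc p)
    -- `Mor(I, Λ ⊗ Λ) ∩ ker (R + 1) = 0`
    (h₂ : ∀ M : Matrix (I × I) Unit ℂ, IsMor (trivialRep A) (Λ ⊗ₖ Λ) M →
      (matR Λ f + 1) * M = 0 → M = 0)
    -- `Mor(I, Λ ⊗ Λ ⊗ Λ) = 0`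
    (h₃ : ∀ M : Matrix (I × I × I) Unit ℂ, IsMor (trivialRep A) (Λ ⊗ₖ (Λ ⊗ₖ Λ)) M → M = 0) :
    -- the universal algebra carries the `*`-structure and the coaction of the statement,
    ∃ (_ : StarRing (MinkowskiAlgebra (matR Λ f) (matZ Λ η) T))
      (_ : StarModule ℂ (MinkowskiAlgebra (matR Λ f) (matZ Λ η) T))
      (Ψ₀ : MinkowskiAlgebra (matR Λ f) (matZ Λ η) T →⋆ₐ[ℂ]
        B ⊗[ℂ] MinkowskiAlgebra (matR Λ f) (matZ Λ η) T),
      (∀ i, star (MinkowskiAlgebra.x (matR Λ f) (matZ Λ η) T i) =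
        MinkowskiAlgebra.x (matR Λ f) (matZ Λ η) T i) ∧
      (∀ i, Ψ₀ (MinkowskiAlgebra.x (matR Λ f) (matZ Λ η) T i) =
        ∑ j, inc (Λ i j) ⊗ₜ[ℂ] MinkowskiAlgebra.x (matR Λ f) (matZ Λ η) T j
          + p i ⊗ₜ[ℂ] (1 : MinkowskiAlgebra (matR Λ f) (matZ Λ η) T)) ∧
      -- it is an analogue of Minkowski space,
      IsMinkowski Λ inc p Ψ₀ ∧
      -- and the analogues of Minkowski space are exactly the pairs `*`-isomorphic to it
      ∀ (C : Type w) [Ring C] [Algebra ℂ C] [StarRing C] [StarModule ℂ C]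
        (Ψ : C →⋆ₐ[ℂ] B ⊗[ℂ] C),
        IsMinkowski Λ inc p Ψ ↔
          ∃ e : C ≃⋆ₐ[ℂ] MinkowskiAlgebra (matR Λ f) (matZ Λ η) T,
            ∀ c, (e : C →⋆ₐ[ℂ] MinkowskiAlgebra (matR Λ f) (matZ Λ η) T).toAlgHom.toLinearMap.lTensor
              B (Ψ c) = Ψ₀ (e c) := by
  exact theorem5p6_general Λ hH.irreducible hH.star_Λ (fun _ => hH.eq_zero_of_isMor) inc p f η T
    hG hd hs h₂
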